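/- Identify $\mathbb R^2$ with $\mathbb C$ via $z=x+\mathrm i y$. In units $\hbar=m^*=|q|=1$ and with magnetic field $B=2$, let $\pi_x=-\mathrm i\partial_x+y$, $\pi_y=-\mathrm i\partial_y-x$, $H=\frac12(\pi_x^2+\pi_y^2)$ and $a=\frac12(-\pi_y+\mathrm i\pi_x)=\frac12 z+\partial_{\bar z}$, so that $H=2(a^\dagger a+\frac12)$ (the operators act in the sense of distributions). For $n=0,1,2,\dots$ let the $n$-th Landau level $n\mathrm{LL}$ be the eigenspace of $H$ in $L^2(\mathbb R^2)$ for the eigenvalue $(n+\frac12)B=2n+1$, put $\mathrm{LLL}=0\mathrm{LL}$, and let $U_n=(n!)^{-1/2}a^n$ restricted to $n\mathrm{LL}$. For $N\ge1$ let $n\mathrm{LL}^N\subset L^2(\mathbb R^{2N})$ be the antisymmetric (fermions) or symmetric (bosons) part of the Hilbert space tensor power $n\mathrm{LL}^{\otimes N}$, $\mathrm{LLL}^N=0\mathrm{LL}^N$ (with the same symmetry), and let $\mathcal U_{N,n}=U_n\otimes\cdots\otimes U_n$, the closure of the algebraic tensor product of $N$ copies of $U_n$. For an $N$-particle wave function $\Psi$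 and $1\le\ell\le N$ the $\ell$-particle density is $$\rho^{(\ell)}_\Psi(\mathbf r_1,\dots,\mathbf r_\ell)=\binom N\ell\int_{\mathbb R^{2(N-\ell)}}|\Psi(\mathbf r_1,\dots,\mathbf r_\ell,\mathbf r'_{\ell+1},\dots,\mathbf r'_N)|^2\,\mathrm d\mathbf r'_{\ell+1}\cdots\mathrm d\mathbf r'_N .$$ **Theorem (Particle densities in the $n$-th Landau level).** Let $n\ge0$, $1\le\ell\le N$ and $\Psi_n\in n\mathrm{LL}^N$. Then $\Psi_0=\mathcal U_{N,n}\Psi_n$ is well defined and belongs to $\mathrm{LLL}^N$; $\Psi_n$ and $\Psi_0$ have (unique) smooth representatives; for these representatives the integrals defining $\rho^{(\ell)}_{\Psi_n}$ and $\rho^{(\ell)}_{\Psi_0}$ converge at every point, $\rho^{(\ell)}_{\Psi_0}$ is smooth, and for all $\mathbf r_1,\dots,\mathbf r_\ell\in\mathbb R^2$ $$\rho^{(\ell)}_{\Psi_n}(\mathbf r_1,\dots,\mathbf r_\ell)=\prod_{i=1}^\ell L_n\!\left(-\tfrac14\Delta_{\mathbf r_i}\right)\rho^{(\ell)}_{\Psi_0}(\mathbf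 r_1,\dots,\mathbf r_\ell),$$ where $\Delta_{\mathbf r_i}$ is the Laplacian in the variable $\mathbf r_i$ and $L_n(t)=\sum_{l=0}^n\binom nl\frac{(-t)^l}{l!}$ is the $n$-th Laguerre polynomial. -/

import Mathlib

open MeasureTheory SchwartzMap LineDeriv Laplacian
open scoped ContDiff

noncomputable section

namespace QuantumHall

/-! ### One particle: operators on tempered distributions on the plane `ℝ² = ℂ`

Units are `ħ = m = |q| = 1` and `B = 2`, so the magnetic length is `1 / √2`. -/

/-- The Hilbert space `L²(ℝ²)`, with `ℝ²` identified with `ℂ` through `z = x + i y`. -/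
abbrev OneBody := Lp ℂ 2 (volume : Measure ℂ)

/-- The coordinate functions have temperate growth, so that multiplication by them is a genuine
operator on tempered distributions. -/
theorem hasTemperateGrowth_re : (fun z : ℂ => (z.re : ℂ)).HasTemperateGrowth :=
  (Complex.ofRealCLM.comp Complex.reCLM).hasTemperateGrowth

theorem hasTemperateGrowth_im : (fun z : ℂ => (z.im : ℂ)).HasTemperateGrowth :=
  (Complex.ofRealCLM.comp Complex.imCLM).hasTemperateGrowth

/-- `π_x = -i ∂_x + (B/2) y` with `B = 2`. -/
def piX : 𝓢'(ℂ, ℂ) →L[ℂ] 𝓢'(ℂ, ℂ) :=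
  (-Complex.I) • lineDerivOpCLM ℂ 𝓢'(ℂ, ℂ) (1 : ℂ)
    + TemperedDistribution.smulLeftCLM ℂ (fun z : ℂ => (z.im : ℂ))

/-- `π_y = -i ∂_y - (B/2) x` with `B = 2`. -/
def piY : 𝓢'(ℂ, ℂ) →L[ℂ] 𝓢'(ℂ, ℂ) :=
  (-Complex.I) • lineDerivOpCLM ℂ 𝓢'(ℂ, ℂ) Complex.I
    - TemperedDistribution.smulLeftCLM ℂ (fun z : ℂ => (z.re : ℂ))

/-- The magnetic Hamiltonian `H = (π_x² + π_y²) / 2`. -/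
def hamiltonian : 𝓢'(ℂ, ℂ) →L[ℂ] 𝓢'(ℂ, ℂ) :=
  (1 / 2 : ℂ) • (piX ∘L piX + piY ∘L piY)

/-- The lowering operator `a = (ℓ_B / √2) (-π_y + i π_x) = (-π_y + i π_x) / 2 = z / 2 + ∂_{z̄}`;
one has `H = B (a† a + 1/2) = 2 a† a + 1`. -/
def lowering : 𝓢'(ℂ, ℂ) →L[ℂ] 𝓢'(ℂ, ℂ) :=
  (1 / 2 : ℂ) • (-piY + Complex.I • piX)

/-- The `n`-th Landau level: the eigenspace in `L²(ℝ²)` of `H` for the eigenvalue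
`(n + 1/2) B = 2 n + 1`. The operator `H` acts in the sense of distributions, i.e. its domain in
`L²` consists of all `ψ ∈ L²` with `H ψ ∈ L²`. -/
def landauLevel (n : ℕ) : Submodule ℂ OneBody :=
  (Module.End.eigenspace (hamiltonian : 𝓢'(ℂ, ℂ) →ₗ[ℂ] 𝓢'(ℂ, ℂ)) (2 * (n : ℂ) + 1)).comap
    (Lp.toTemperedDistributionCLM ℂ (volume : Measure ℂ) 2 : OneBody →ₗ[ℂ] 𝓢'(ℂ, ℂ))

/-- `χ = U_n ψ`, where `U_n = (n!)^{-1/2} a^n` restricted to the `n`-th Landau level. -/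
def IsLevelLowering (n : ℕ) (ψ χ : OneBody) : Prop :=
  ψ ∈ landauLevel n ∧
    (((Real.sqrt (n.factorial : ℝ))⁻¹ : ℝ) : ℂ) •
      (lowering ^ n) (Lp.toTemperedDistribution ψ) = Lp.toTemperedDistribution χ

/-! ### Many particles -/

/-- The `N`-particle Hilbert space `L²(ℝ^{2N}) = L²(ℝ²)^{⊗N}`. -/
abbrev ManyBody (N : ℕ) := Lp ℂ 2 (volume : Measure (Fin N → ℂ))

theorem memLp_tensor {N : ℕ} (ψ : Fin N → OneBody) :
    MemLp (fun r : Fin N → ℂ => ∏ i, ψ i (r i)) 2 volume := by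
  have hm : AEStronglyMeasurable (fun r : Fin N → ℂ => ∏ i, ψ i (r i)) volume := by
    refine Finset.aestronglyMeasurable_fun_prod _ fun i _ => ?_
    exact (Lp.aestronglyMeasurable (ψ i)).comp_quasiMeasurePreserving
      (Measure.quasiMeasurePreserving_eval (fun _ : Fin N => (volume : Measure ℂ)) i)
  rw [memLp_two_iff_integrable_sq_norm hm]
  have h : ∀ i, Integrable (fun z : ℂ => ‖ψ i z‖ ^ 2) volume := fun i =>
    (memLp_two_iff_integrable_sq_norm (Lp.aestronglyMeasurable (ψ i))).1 (Lp.memLp (ψ i))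
  simpa [norm_prod, Finset.prod_pow, volume_pi] using Integrable.fintype_prod h

/-- The product state `ψ₁ ⊗ ⋯ ⊗ ψ_N`, i.e. `(r₁, …, r_N) ↦ ψ₁(r₁) ⋯ ψ_N(r_N)`. -/
def tensor {N : ℕ} (ψ : Fin N → OneBody) : ManyBody N := (memLp_tensor ψ).toLp _

/-- Bose or Fermi statistics. -/
inductive Statistics
  | bose
  | fermi

/-- The factor that a wave function picks up under a permutation of the particles. -/
def Statistics.factor (s : Statistics) {N : ℕ} (σ : Equiv.Perm (Fin N)) : ℂ :=
  match s with
  | .bose => 1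
  | .fermi => ((Equiv.Perm.sign σ : ℤ) : ℂ)

theorem measurePreserving_perm {N : ℕ} (σ : Equiv.Perm (Fin N)) :
    MeasurePreserving (fun r : Fin N → ℂ => fun i => r (σ i)) volume volume :=
  (volume_measurePreserving_piCongrLeft (fun _ : Fin N => ℂ) σ).symm

/-- The symmetric (Bose) or antisymmetric (Fermi) functions in `L²(ℝ^{2N})`. -/
def symmetricStates (s : Statistics) (N : ℕ) : Submodule ℂ (ManyBody N) :=
  ⨅ σ : Equiv.Perm (Fin N), LinearMap.eqLocus
    (Lp.compMeasurePreservingₗ ℂ _ (measurePreserving_perm σ) : ManyBody N →ₗ[ℂ] ManyBody N)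
    (s.factor σ • LinearMap.id)

/-- The `N`-particle space of the `n`-th Landau level: the symmetric or antisymmetric part of the
Hilbert space tensor power of `landauLevel n`. -/
def manyBodyLevel (s : Statistics) (n N : ℕ) : Submodule ℂ (ManyBody N) :=
  (Submodule.span ℂ {Ψ | ∃ ψ : Fin N → OneBody,
      (∀ i, ψ i ∈ landauLevel n) ∧ Ψ = tensor ψ}).topologicalClosure ⊓ symmetricStates s N

/-- The graph of the operator `U_{N,n} = U_n ⊗ ⋯ ⊗ U_n` (the closure of the algebraic tensor
product, whose graph is spanned by the pairs `(⊗ ψ_i, ⊗ U_n ψ_i)`). -/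
def levelLoweringGraph (n N : ℕ) : Submodule ℂ (ManyBody N × ManyBody N) :=
  (Submodule.span ℂ {P | ∃ ψ χ : Fin N → OneBody,
      (∀ i, IsLevelLowering n (ψ i) (χ i)) ∧ P = (tensor ψ, tensor χ)}).topologicalClosure

/-! ### Particle densities and the Laguerre operator -/

/-- The configuration `(r₁, …, r_ℓ, r'_{ℓ+1}, …, r'_N)`. -/
def joinConfig {N ℓ : ℕ} (r : Fin ℓ → ℂ) (r' : Fin (N - ℓ) → ℂ) : Fin N → ℂ :=
  fun i => if h : (i : ℕ) < ℓ then r ⟨i, h⟩ else r' ⟨(i : ℕ) - ℓ, by omega⟩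

/-- The `ℓ`-particle density of an `N`-particle wave function. -/
def particleDensity {N : ℕ} (ℓ : ℕ) (f : (Fin N → ℂ) → ℂ) (r : Fin ℓ → ℂ) : ℝ :=
  (N.choose ℓ : ℝ) * ∫ r' : Fin (N - ℓ) → ℂ, ‖f (joinConfig r r')‖ ^ 2

/-- The Laplacian with respect to the `i`-th variable `r_i ∈ ℝ²`. -/
def partialLaplacian {ℓ : ℕ} (i : Fin ℓ) (g : (Fin ℓ → ℂ) → ℝ) : (Fin ℓ → ℂ) → ℝ :=
  fun r => (Δ (fun w : ℂ => g (Function.update r i w))) (r i)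

/-- The Laguerre polynomial `L_n(t) = ∑_{k=0}^n (n choose k) (-t)^k / k!`. -/
def laguerre (n : ℕ) : Polynomial ℝ :=
  ∑ k ∈ Finset.range (n + 1),
    Polynomial.C ((n.choose k : ℝ) * (-1) ^ k / (k.factorial : ℝ)) * Polynomial.X ^ k

/-- The differential operator `L_n(-Δ_{r_i} / 4)`. -/
def laguerreOp (n : ℕ) {ℓ : ℕ} (i : Fin ℓ) (g : (Fin ℓ → ℂ) → ℝ) : (Fin ℓ → ℂ) → ℝ :=
  (laguerre n).sum fun k c => c • (fun h => (-1 / 4 : ℝ) • partialLaplacian i h)^[k] g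

/-- The differential operator `∏_{i=1}^ℓ L_n(-Δ_{r_i} / 4)`. -/
def laguerreProduct (n ℓ : ℕ) (g : (Fin ℓ → ℂ) → ℝ) : (Fin ℓ → ℂ) → ℝ :=
  (List.finRange ℓ).foldr (laguerreOp n) g

end QuantumHall

end

/-! The special Hermite functions `landauVec (m, k)`, obtained from the Gaussian by two commuting
pairs of ladder operators, form an orthonormal basis of L²(ℝ²), and the n-th Landau level is the
closed span of those with m = n. Hence U_n is unitary onto the lowest level, sending `landauVec (n,
k)` to `landauVec (0, k)`, and the value of ψ at z is the inner product of U_n ψ with a vector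
`landauKernel n z` built from the basis of the lowest level. All wave functions with the same
lowered state Ψ₀ thus differ only in the kernel K_n.

Pairing Ψ₀ with K_n(r₁) ⊗ ⋯ ⊗ K_n(r_ℓ) in its first ℓ particles leaves a state of N - ℓ particles in
the lowest level, and integrating out the other variables gives its squared norm, again by
unitarity. So the density is binom(N, ℓ) ‖A(K_n(r₁) ⊗ ⋯ ⊗ K_n(r_ℓ))‖² with an antilinear A
independent of n (`particleDensity_levelFun`). This makes sense at every point and is smooth.

In each variable separately, the vectors inside the norm form a ladder X_k: a and a† shift k. For
g_k = ‖X_k‖² the magnetic terms cancel, and ∂_z ∂_{z̄} g_k is a combination of g_{k-1}, g_k, g_{k+1}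
(`IsLadder.laplacian_norm_sq`). As Δ = 4 ∂_z ∂_{z̄}, this is the three-term Laguerre recurrence in
-Δ/4, so g_n = L_n(-Δ/4) g_0 (`laguerreOp_eq`). Doing this one variable at a time proves the formula
(`laguerreProduct_norm_sq`). -/

noncomputable section

namespace QuantumHall

open scoped ComplexConjugate

/-! ### Wirtinger derivatives and ladders of functions -/

section Ladder

variable {V W : Type*} [NormedAddCommGroup V] [InnerProductSpace ℂ V]
  [NormedAddCommGroup W] [InnerProductSpace ℂ W]

/-- The real-linear map `w ↦ w p + w̄ q`. -/
def wirtinger (p q : V) : ℂ →L[ℝ] V :=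
  (ContinuousLinearMap.id ℝ ℂ).smulRight p + (Complex.conjCLE : ℂ →L[ℝ] ℂ).smulRight q

@[simp] theorem wirtinger_apply (p q : V) (w : ℂ) : wirtinger p q w = w • p + conj w • q := rfl

/-- A sequence `X 0, X 1, …` of functions on the plane with
`∂_{z̄} X_k = -(z / 2) X_k + √k X_{k-1}` and `∂_z X_k = (z̄ / 2) X_k - √(k+1) X_{k+1}`. -/
def IsLadder (X : ℕ → ℂ → V) : Prop :=
  ∀ k z, HasFDerivAt (X k)
    (wirtinger ((conj z / 2) • X k z - (√(k + 1 : ℝ) : ℂ) • X (k + 1) z)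
      ((-(z / 2)) • X k z + (√(k : ℝ) : ℂ) • X (k - 1) z)) z

/-- The complex conjugate of the notion of a ladder. -/
def IsConjLadder (X : ℕ → ℂ → V) : Prop :=
  ∀ k z, HasFDerivAt (X k)
    (wirtinger ((-(conj z / 2)) • X k z + (√(k : ℝ) : ℂ) • X (k - 1) z)
      ((z / 2) • X k z - (√(k + 1 : ℝ) : ℂ) • X (k + 1) z)) z

/-- An antilinear map exchanges ∂_z and ∂_{z̄} and conjugates coefficients. Kernels sit in the
antilinear slot of the inner product, so they form conjugate ladders while wave functions form
ladders. -/
theorem IsConjLadder.map {X : ℕ → ℂ → V} (hX : IsConjLadder X) (L : V →L⋆[ℂ] W) :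
    IsLadder fun k z => L (X k z) := by
  intro k z
  let L' : V →L[ℝ] W :=
    { toFun := L
      map_add' := map_add L
      map_smul' := fun r x => by
        have := L.map_smulₛₗ (r : ℂ) x
        simpa using this
      cont := L.continuous }
  have h := L'.hasFDerivAt.comp z (hX k z)
  refine h.congr_fderiv (ContinuousLinearMap.ext fun w => ?_)
  rw [ContinuousLinearMap.comp_apply, show ∀ x, L' x = L x from fun _ => rfl]
  simp only [wirtinger_apply, map_add, map_sub, L.map_smulₛₗ, map_neg, map_div₀, map_ofNat,
    Complex.conj_ofReal, Complex.conj_conj]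
  module

/-- Bootstrapping: the derivatives are expressed through the functions themselves, so C^m for the
whole family gives C^{m+1}. -/
theorem contDiff_of_hasFDerivAt_wirtinger {X : ℕ → ℂ → V} {p q : ℕ → ℂ → V}
    (h : ∀ k z, HasFDerivAt (X k) (wirtinger (p k z) (q k z)) z)
    (hpq : ∀ m : ℕ, (∀ k, ContDiff ℝ m (X k)) → ∀ k, ContDiff ℝ m (p k) ∧ ContDiff ℝ m (q k))
    (k : ℕ) : ContDiff ℝ ∞ (X k) := by
  have key : ∀ m : ℕ, ∀ k, ContDiff ℝ m (X k) := by
    intro m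
    induction m with
    | zero =>
      intro k
      exact contDiff_zero.2 (continuous_iff_continuousAt.2 fun z => (h k z).continuousAt)
    | succ m ih =>
      intro k
      refine (contDiff_succ_iff_hasFDerivAt (n := m)).2 ⟨fun z => wirtinger (p k z) (q k z), ?_, h k⟩
      refine contDiff_clm_apply_iff.2 fun w => ?_
      exact ((hpq m ih k).1.const_smul w).add ((hpq m ih k).2.const_smul (conj w))
  exact contDiff_infty.2 fun m => key m k

theorem IsConjLadder.contDiff {X : ℕ → ℂ → V} (hX : IsConjLadder X) (k : ℕ) :
    ContDiff ℝ ∞ (X k) := by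
  refine contDiff_of_hasFDerivAt_wirtinger hX (fun m h k => ⟨?_, ?_⟩) k
  · refine ContDiff.add (ContDiff.smul ?_ (h k)) ((h (k - 1)).const_smul _)
    exact ((Complex.conjCLE : ℂ →L[ℝ] ℂ).contDiff.div_const 2).neg
  · exact ContDiff.sub (ContDiff.smul (contDiff_id.div_const 2) (h k)) ((h (k + 1)).const_smul _)

/-- Here q = ∂_z g, and dg(w) = 2 Re(q w) because g is real. The second derivatives along 1 and i
are 2 Re(s + t) and 2 Re(t - s), so only t = ∂_{z̄} q survives in the sum. -/
theorem laplacian_eq_of_hasFDerivAt {g : ℂ → ℝ} {q : ℂ → ℂ} {z s t : ℂ}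
    (hg : ∀ z, HasFDerivAt g (2 • Complex.reCLM.comp (ContinuousLinearMap.mul ℝ ℂ (q z))) z)
    (hq : HasFDerivAt q (wirtinger s t) z) : Δ g z = 4 * t.re := by
  have h1 : fderiv ℝ g = fun z => 2 • Complex.reCLM.comp (ContinuousLinearMap.mul ℝ ℂ (q z)) :=
    funext fun z => (hg z).fderiv
  have h2 : HasFDerivAt (fderiv ℝ g)
      ((2 • (ContinuousLinearMap.compL ℝ ℂ ℂ ℝ Complex.reCLM).comp
        (ContinuousLinearMap.mul ℝ ℂ)).comp (wirtinger s t)) z := by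
    rw [h1]
    exact ((2 • (ContinuousLinearMap.compL ℝ ℂ ℂ ℝ Complex.reCLM).comp
        (ContinuousLinearMap.mul ℝ ℂ)).hasFDerivAt).comp z hq
  rw [InnerProductSpace.laplacian_eq_iteratedFDeriv_complexPlane]
  simp only [iteratedFDeriv_two_apply, h2.fderiv]
  simp
  ring

/-- The terms ±z/2 and ±z̄/2 from the two slots cancel, leaving only index shifts with constant
coefficients. -/
theorem IsLadder.hasFDerivAt_inner {X : ℕ → ℂ → V} (hX : IsLadder X) (j k : ℕ) (z : ℂ) :
    HasFDerivAt (fun z => inner ℂ (X j z) (X k z))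
      (wirtinger
        ((√(j : ℝ) : ℂ) * inner ℂ (X (j - 1) z) (X k z)
          - (√(k + 1 : ℝ) : ℂ) * inner ℂ (X j z) (X (k + 1) z))
        ((√(k : ℝ) : ℂ) * inner ℂ (X j z) (X (k - 1) z)
          - (√(j + 1 : ℝ) : ℂ) * inner ℂ (X (j + 1) z) (X k z))) z := by
  refine ((hX j z).inner ℂ (hX k z)).congr_fderiv (ContinuousLinearMap.ext fun w => ?_)
  simp only [ContinuousLinearMap.comp_apply, ContinuousLinearMap.prod_apply, fderivInnerCLM_apply,
    wirtinger_apply, inner_add_left, inner_add_right, inner_sub_left, inner_sub_right,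
    inner_smul_left, inner_smul_right, smul_eq_mul, map_neg, map_div₀, map_ofNat,
    Complex.conj_ofReal, Complex.conj_conj]
  ring

/-- Along a ladder, `g_k = ‖X_k‖²` has `∂_z ∂_{z̄} g_k = k g_{k-1} - (2k+1) g_k + (k+1) g_{k+1}`. -/
theorem IsLadder.laplacian_norm_sq {X : ℕ → ℂ → V} (hX : IsLadder X) (k : ℕ) (z : ℂ) :
    Δ (fun z => ‖X k z‖ ^ 2) z =
      4 * (k * ‖X (k - 1) z‖ ^ 2 - (2 * k + 1) * ‖X k z‖ ^ 2 + (k + 1) * ‖X (k + 1) z‖ ^ 2) := by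
  -- This is ∂_z of ‖X_k‖²; by reality ∂_{z̄} is its conjugate.
  let q : ℂ → ℂ := fun z => (√(k : ℝ) : ℂ) * inner ℂ (X (k - 1) z) (X k z)
    - (√(k + 1 : ℝ) : ℂ) * inner ℂ (X k z) (X (k + 1) z)
  have hg : ∀ z, HasFDerivAt (fun z => ‖X k z‖ ^ 2)
      (2 • Complex.reCLM.comp (ContinuousLinearMap.mul ℝ ℂ (q z))) z := by
    intro z
    have h := Complex.reCLM.hasFDerivAt.comp z (hX.hasFDerivAt_inner k k z)
    have he : (fun z => ‖X k z‖ ^ 2) = Complex.reCLM ∘ fun z => inner ℂ (X k z) (X k z) := by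
      funext z
      simp [inner_self_eq_norm_sq_to_K, ← Complex.ofReal_pow]
    rw [he]
    refine h.congr_fderiv (ContinuousLinearMap.ext fun w => ?_)
    have hq : (√(k : ℝ) : ℂ) * inner ℂ (X k z) (X (k - 1) z)
        - (√(k + 1 : ℝ) : ℂ) * inner ℂ (X (k + 1) z) (X k z) = conj (q z) := by
      simp [q]
    rw [hq]
    change (wirtinger (q z) (conj (q z)) w).re = _
    simp
    ring
  have hq := ((hX.hasFDerivAt_inner (k - 1) k z).const_mul (√(k : ℝ) : ℂ)).sub
    ((hX.hasFDerivAt_inner k (k + 1) z).const_mul (√(k + 1 : ℝ) : ℂ))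
  have hs : ∀ (a b p q p' q' : ℂ), a • wirtinger p q - b • wirtinger p' q' =
      wirtinger (a * p - b * p') (a * q - b * q') := by
    intro a b p q p' q'
    refine ContinuousLinearMap.ext fun w => ?_
    simp
    ring
  rw [hs] at hq
  rw [laplacian_eq_of_hasFDerivAt hg hq]
  congr 1
  have e1 : (√(k + 1 : ℝ) : ℂ) * (√(k + 1 : ℝ) : ℂ) = k + 1 := by
    rw [← Complex.ofReal_mul, Real.mul_self_sqrt (by positivity)]; simp
  have e2 : (√(k : ℝ) : ℂ) * (√(k : ℝ) : ℂ) = k := by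
    rw [← Complex.ofReal_mul, Real.mul_self_sqrt (by positivity)]; simp
  -- At k = 0 the truncated index k - 1 + 1 is not k, but then the factor √k vanishes.
  have e3 : (√(k : ℝ) : ℂ) * (√((k - 1 : ℕ) + 1 : ℝ) : ℂ) * inner ℂ (X (k - 1 + 1) z) (X k z) =
      k * ((‖X k z‖ : ℂ) ^ 2) := by
    cases k with
    | zero => simp
    | succ k => 
      simp only [Nat.add_sub_cancel, inner_self_eq_norm_sq_to_K] 
      rw [← e2]
      simp
  have e4 : ∀ j, inner ℂ (X j z) (X j z) = (‖X j z‖ : ℂ) ^ 2 := fun j =>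
    inner_self_eq_norm_sq_to_K _
  simp only [Nat.add_sub_cancel, mul_sub, ← mul_assoc, e3, e2]
  push_cast
  simp only [e1, e4]
  norm_cast
  push_cast
  ring

end Ladder

/-! ### Laguerre polynomials of the Laplacian -/

section Laguerre

theorem coeff_laguerre (n k : ℕ) :
    (laguerre n).coeff k = (n.choose k : ℝ) * (-1) ^ k / (k.factorial : ℝ) := by
  simp only [laguerre, Polynomial.finsetSum_coeff, Polynomial.coeff_C_mul, Polynomial.coeff_X_pow,
    mul_ite, mul_one, mul_zero, Finset.sum_ite_eq, Finset.mem_range]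
  split_ifs with h
  · rfl
  · rw [Nat.choose_eq_zero_of_lt (by omega)]
    simp

theorem laguerre_zero : laguerre 0 = 1 := by
  simp [laguerre]

/-- The three-term recurrence of the Laguerre polynomials. -/
theorem laguerre_succ (n : ℕ) :
    (n + 1 : ℝ) • laguerre (n + 1) =
      (2 * n + 1 : ℝ) • laguerre n - Polynomial.X * laguerre n - (n : ℝ) • laguerre (n - 1) := by
  ext k
  simp only [Polynomial.coeff_smul, Polynomial.coeff_sub, smul_eq_mul, coeff_laguerre]
  cases k with
  | zero => simp; ring
  | succ k =>
    rw [Polynomial.coeff_X_mul, coeff_laguerre]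
    cases n with
    | zero =>
      cases k with
      | zero => simp
      | succ k => simp [Nat.choose_eq_zero_of_lt]
    | succ n =>
      -- The recurrence compared at the coefficient of t^(k+1), after clearing factorials.
      have h : ((n + 2 : ℕ) : ℝ) * ((n + 2).choose (k + 1) : ℝ) =
          (2 * (n + 1 : ℕ) + 1) * ((n + 1).choose (k + 1) : ℝ)
            + (k + 1) * ((n + 1).choose k : ℝ) - (n + 1 : ℕ) * (n.choose (k + 1) : ℝ) := by
        have h1 : ((n + 1).choose (k + 1) : ℝ) = n.choose k + n.choose (k + 1) := by
          exact_mod_cast Nat.choose_succ_succ n k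
        have h2 : ((n + 2).choose (k + 1) : ℝ) = (n + 1).choose k + (n + 1).choose (k + 1) := by
          exact_mod_cast Nat.choose_succ_succ (n + 1) k
        have h3 : ((n + 1 : ℕ) : ℝ) * (n.choose k : ℝ) = (n + 1).choose (k + 1) * (k + 1 : ℕ) := by
          exact_mod_cast Nat.add_one_mul_choose_eq n k
        have h4 : ((n + 2 : ℕ) : ℝ) * ((n + 1).choose k : ℝ) =
            (n + 2).choose (k + 1) * (k + 1 : ℕ) := by
          exact_mod_cast Nat.add_one_mul_choose_eq (n + 1) k
        push_cast at *
        rw [h2] at h4 ⊢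
        nlinarith
      have hk : (k.factorial : ℝ) ≠ 0 := by positivity
      rw [Nat.factorial_succ]
      push_cast at h ⊢
      field_simp
      linear_combination (-1) ^ (k + 1) * h

variable {ℓ : ℕ}

/-- The operator `-Δ_{r_i} / 4`. -/
def scaledLaplacian (i : Fin ℓ) (h : (Fin ℓ → ℂ) → ℝ) : (Fin ℓ → ℂ) → ℝ :=
  (-1 / 4 : ℝ) • partialLaplacian i h

/-- A sequence that is smooth in the `i`-th variable and satisfies the Laguerre recurrence for
`-Δ_{r_i} / 4` is obtained from its first term by the Laguerre polynomials of that operator. -/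
theorem laguerreOp_eq (i : Fin ℓ) (G : ℕ → (Fin ℓ → ℂ) → ℝ)
    (hG : ∀ k r, ContDiff ℝ 2 fun w => G k (Function.update r i w))
    (hrec : ∀ k : ℕ, (k + 1 : ℝ) • G (k + 1) =
      (2 * k + 1 : ℝ) • G k - scaledLaplacian i (G k) - (k : ℝ) • G (k - 1)) (n : ℕ) :
    laguerreOp n i (G 0) = G n := by
  -- The Laplacian is not additive on arbitrary functions. On the span of the G k it is, these being
  -- C², and the recurrence keeps the span invariant. There it becomes an endomorphism D to which
  -- polynomial calculus applies, and no smoothness beyond C² is needed for its iterates.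
  let S : Submodule ℝ ((Fin ℓ → ℂ) → ℝ) := Submodule.span ℝ (Set.range G)
  have hGS : ∀ k, G k ∈ S := fun k => Submodule.subset_span ⟨k, rfl⟩
  have hsm : ∀ g ∈ S, ∀ r, ContDiff ℝ 2 fun w => g (Function.update r i w) := by
    intro g hg
    induction hg using Submodule.span_induction with
    | mem g hg => obtain ⟨k, rfl⟩ := hg; exact hG k
    | zero => exact fun r => contDiff_const
    | add f g _ _ hf hg => exact fun r => (hf r).add (hg r)
    | smul c f _ hf => exact fun r => (hf r).const_smul c
  have hadd : ∀ f ∈ S, ∀ g ∈ S,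
      scaledLaplacian i (f + g) = scaledLaplacian i f + scaledLaplacian i g := by
    intro f hf g hg
    funext r
    have := ((hsm f hf r).contDiffAt (x := r i)).laplacian_add (hsm g hg r).contDiffAt
    simp only [scaledLaplacian, partialLaplacian, Pi.smul_apply, Pi.add_apply, smul_eq_mul]
    rw [← mul_add, ← this]
    rfl
  have hsmul : ∀ (c : ℝ), ∀ f ∈ S, scaledLaplacian i (c • f) = c • scaledLaplacian i f := by
    intro c f hf
    funext r
    have := InnerProductSpace.laplacian_smul c ((hsm f hf r).contDiffAt (x := r i))
    simp only [scaledLaplacian, partialLaplacian, Pi.smul_apply, smul_eq_mul] at this ⊢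
    rw [mul_left_comm, ← this]
    rfl
  have hmem : ∀ g ∈ S, scaledLaplacian i g ∈ S := by
    intro g hg
    induction hg using Submodule.span_induction with
    | mem g hg =>
      obtain ⟨k, rfl⟩ := hg
      have : scaledLaplacian i (G k) =
          (2 * k + 1 : ℝ) • G k - (k : ℝ) • G (k - 1) - (k + 1 : ℝ) • G (k + 1) := by
        rw [hrec k]; abel
      rw [this]
      exact S.sub_mem (S.sub_mem (S.smul_mem _ (hGS _)) (S.smul_mem _ (hGS _)))
        (S.smul_mem _ (hGS _))
    | zero =>
      have := hsmul 0 0 S.zero_mem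
      rw [zero_smul, zero_smul] at this
      rw [this]
      exact S.zero_mem
    | add f g hf' hg' hf hg => rw [hadd f hf' g hg']; exact S.add_mem hf hg
    | smul c f hf' hf => rw [hsmul c f hf']; exact S.smul_mem _ hf
  let D : Module.End ℝ S :=
    { toFun := fun g => ⟨scaledLaplacian i g, hmem g g.2⟩
      map_add' := fun f g => Subtype.ext (hadd f f.2 g g.2)
      map_smul' := fun c f => Subtype.ext (hsmul c f f.2) }
  have hpow : ∀ (k : ℕ) (g : S), (((D ^ k) g : S) : (Fin ℓ → ℂ) → ℝ) =
      (scaledLaplacian i)^[k] g := by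
    intro k g
    induction k with
    | zero => rfl
    | succ k ih =>
      rw [pow_succ', Module.End.mul_apply, Function.iterate_succ_apply', ← ih]
      rfl
  let G' : ℕ → S := fun k => ⟨G k, hGS k⟩
  have hrec' : ∀ k : ℕ, (k + 1 : ℝ) • G' (k + 1) =
      (2 * k + 1 : ℝ) • G' k - D (G' k) - (k : ℝ) • G' (k - 1) :=
    fun k => Subtype.ext (hrec k)
  have key : ∀ n, Polynomial.aeval D (laguerre n) (G' 0) = G' n ∧
      Polynomial.aeval D (laguerre (n + 1)) (G' 0) = G' (n + 1) := by
    -- The second hypothesis carries the factor n so that it is void at n = 0, where n - 1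
    -- truncates.
    have step : ∀ n, Polynomial.aeval D (laguerre n) (G' 0) = G' n →
        (n : ℝ) • Polynomial.aeval D (laguerre (n - 1)) (G' 0) = (n : ℝ) • G' (n - 1) →
        Polynomial.aeval D (laguerre (n + 1)) (G' 0) = G' (n + 1) := by
      intro n h1 h2
      have h := congrArg (fun p => Polynomial.aeval D p (G' 0)) (laguerre_succ n)
      simp only [map_sub, map_smul, map_mul, Polynomial.aeval_X, LinearMap.sub_apply,
        LinearMap.smul_apply, Module.End.mul_apply, h1, h2] at h
      rw [← hrec' n] at h
      exact smul_right_injective _ (by positivity : (n + 1 : ℝ) ≠ 0) h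
    intro n
    induction n with
    | zero =>
      have h0 : Polynomial.aeval D (laguerre 0) (G' 0) = G' 0 := by simp [laguerre_zero]
      exact ⟨h0, step 0 h0 (by simp)⟩
    | succ n ih => exact ⟨ih.2, step (n + 1) ih.2 (by simp [ih.1])⟩
  have h := congrArg Subtype.val (key n).1
  rw [Polynomial.aeval_eq_sum_range, LinearMap.sum_apply] at h
  rw [laguerreOp, Polynomial.sum_over_range]
  · refine Eq.trans ?_ h
    rw [AddSubmonoidClass.coe_finsetSum]
    refine Finset.sum_congr rfl fun k _ => ?_
    rw [LinearMap.smul_apply, Submodule.coe_smul, hpow]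
    rfl
  · intro k
    exact zero_smul _ _

/-- Each operator in the fold raises its own index from 0 to n and leaves the others alone; `Nodup`
guarantees that this index is still 0 when its turn comes. -/
theorem laguerreProduct_eq_aux (n : ℕ) (G : (Fin ℓ → ℕ) → (Fin ℓ → ℂ) → ℝ)
    (hG : ∀ ν i r, ContDiff ℝ 2 fun w => G ν (Function.update r i w))
    (hrec : ∀ ν i, (ν i + 1 : ℝ) • G (Function.update ν i (ν i + 1)) =
      (2 * ν i + 1 : ℝ) • G ν - scaledLaplacian i (G ν)
        - (ν i : ℝ) • G (Function.update ν i (ν i - 1))) (L : List (Fin ℓ)) (hL : L.Nodup) :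
    L.foldr (laguerreOp n) (G 0) = G fun i => if i ∈ L then n else 0 := by
  induction L with
  | nil => simp; rfl
  | cons i L ih =>
    rw [List.nodup_cons] at hL
    rw [List.foldr_cons, ih hL.2]
    set ν : Fin ℓ → ℕ := fun j => if j ∈ L then n else 0 with hν
    have hi : ν i = 0 := by simp [hν, hL.1]
    have h := laguerreOp_eq i (fun k => G (Function.update ν i k)) (fun k r => hG _ i r)
      (fun k => by simpa using hrec (Function.update ν i k) i) n
    rw [show Function.update ν i 0 = ν by rw [← hi, Function.update_eq_self]] at h
    rw [h]
    congr 1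
    funext j
    by_cases hj : j = i
    · subst hj; simp
    · simp [hj, hν]

/-- The several-variable version of `laguerreOp_eq`. -/
theorem laguerreProduct_eq (n : ℕ) (G : (Fin ℓ → ℕ) → (Fin ℓ → ℂ) → ℝ)
    (hG : ∀ ν i r, ContDiff ℝ 2 fun w => G ν (Function.update r i w))
    (hrec : ∀ ν i, (ν i + 1 : ℝ) • G (Function.update ν i (ν i + 1)) =
      (2 * ν i + 1 : ℝ) • G ν - scaledLaplacian i (G ν)
        - (ν i : ℝ) • G (Function.update ν i (ν i - 1))) :
    laguerreProduct n ℓ (G 0) = G fun _ => n := by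
  rw [laguerreProduct, laguerreProduct_eq_aux n G hG hrec _ (List.nodup_finRange ℓ)]
  simp

end Laguerre

/-! ### The Gaussian as a Schwartz function -/

/-- The power is absorbed by M! e^{1+t}, and 1 + t - t²/2 has maximum 3/2, attained at t = 1. -/
theorem one_add_pow_mul_exp_le (M : ℕ) {t : ℝ} (ht : 0 ≤ t) :
    (1 + t) ^ M * Real.exp (-(t ^ 2 / 2)) ≤ M.factorial * Real.exp (3 / 2) := by
  have h1 : (1 + t) ^ M ≤ M.factorial * Real.exp (1 + t) := by
    have := Real.pow_div_factorial_le_exp (x := 1 + t) (by positivity) M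
    rwa [div_le_iff₀ (by positivity), mul_comm] at this
  calc (1 + t) ^ M * Real.exp (-(t ^ 2 / 2))
      ≤ M.factorial * Real.exp (1 + t) * Real.exp (-(t ^ 2 / 2)) := by gcongr
    _ = M.factorial * Real.exp (1 + t - t ^ 2 / 2) := by
      rw [mul_assoc, ← Real.exp_add]; ring_nf
    _ ≤ M.factorial * Real.exp (3 / 2) := by
      gcongr
      nlinarith [sq_nonneg (t - 1)]

/-- The real Gaussian `e^{-|z|²/2}`. -/
def realGaussian : 𝓢(ℂ, ℝ) where
  toFun := Real.exp ∘ fun z => -(‖z‖ ^ 2 / 2)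
  smooth' := Real.contDiff_exp.comp (((contDiff_norm_sq ℝ).div_const 2).neg)
  decay' := by
    intro k n
    have hq : (fun z : ℂ => -(‖z‖ ^ 2 / 2)).HasTemperateGrowth := by
      have h := ((Function.hasTemperateGrowth_norm_sq (H := ℂ)).mul
        (Function.HasTemperateGrowth.const (1 / 2 : ℝ))).neg
      have e : (fun z : ℂ => -(‖z‖ ^ 2 / 2)) = -((fun z : ℂ => ‖z‖ ^ 2) * fun _ => (1 / 2 : ℝ)) := by
        funext z
        change -(‖z‖ ^ 2 / 2) = -(‖z‖ ^ 2 * (1 / 2))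
        ring
      rw [e]
      exact h
    obtain ⟨m, C, hC, hb⟩ := hq.norm_iteratedFDeriv_le_uniform n
    refine ⟨n.factorial * (C + 1) ^ n * ((k + m * n).factorial * Real.exp (3 / 2)), fun z => ?_⟩
    -- The Faà di Bruno estimate needs the i-th derivative of the exponent bounded by D^i. A bound
    -- by D suffices once D ≥ 1, which is why C is replaced by C + 1.
    have hD1 : 1 ≤ (C + 1) * (1 + ‖z‖) ^ m :=
      one_le_mul_of_one_le_of_one_le (by linarith) (one_le_pow₀ (by linarith [norm_nonneg z]))
    have h := norm_iteratedFDeriv_comp_le (𝕜 := ℝ) (g := Real.exp)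
      (f := fun z : ℂ => -(‖z‖ ^ 2 / 2)) (n := n) (N := ∞) Real.contDiff_exp hq.1
      (by exact_mod_cast le_top) z (C := Real.exp (-(‖z‖ ^ 2 / 2)))
      (D := (C + 1) * (1 + ‖z‖) ^ m)
      (fun i _ => by
        rw [norm_iteratedFDeriv_eq_norm_iteratedDeriv, iteratedDeriv_eq_iterate,
          Real.iter_deriv_exp, Real.norm_eq_abs, Real.abs_exp])
      (fun i hi hin => (hb i hin z).trans
        ((mul_le_mul_of_nonneg_right (by linarith) (by positivity)).trans
          (le_self_pow₀ hD1 (by omega))))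
    have hz : ‖z‖ ^ k ≤ (1 + ‖z‖) ^ k := by gcongr; linarith
    calc ‖z‖ ^ k * ‖iteratedFDeriv ℝ n (Real.exp ∘ fun z : ℂ => -(‖z‖ ^ 2 / 2)) z‖
        ≤ (1 + ‖z‖) ^ k * (n.factorial * Real.exp (-(‖z‖ ^ 2 / 2)) *
            ((C + 1) * (1 + ‖z‖) ^ m) ^ n) := by gcongr
      _ = n.factorial * (C + 1) ^ n *
            ((1 + ‖z‖) ^ (k + m * n) * Real.exp (-(‖z‖ ^ 2 / 2))) := by
        rw [mul_pow, pow_add, pow_mul]; ring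
      _ ≤ _ := mul_le_mul_of_nonneg_left (one_add_pow_mul_exp_le _ (norm_nonneg z)) (by positivity)

/-- The Gaussian `e^{-|z|²/2}`. -/
def gaussian : 𝓢(ℂ, ℂ) :=
  SchwartzMap.postcompCLM (𝕜 := ℝ) Complex.ofRealCLM realGaussian

theorem gaussian_apply (z : ℂ) : gaussian z = (Real.exp (-(‖z‖ ^ 2 / 2)) : ℂ) := rfl

theorem integral_gaussian_sq : ∫ z, gaussian z * gaussian z = Real.pi := by
  have h := GaussianFourier.integral_rexp_neg_mul_sq_norm (V := ℂ) (b := 1) one_pos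
  have h2 : ∀ z, gaussian z * gaussian z = ((Real.exp (-1 * ‖z‖ ^ 2) : ℝ) : ℂ) := by
    intro z
    rw [gaussian_apply, ← Complex.ofReal_mul, ← Real.exp_add]
    ring_nf
  simp_rw [h2]
  rw [integral_complex_ofReal, h]
  simp

/-! ### Ladder operators on Schwartz functions -/

/-- Multiplication by `x`. -/
def mulRe : 𝓢(ℂ, ℂ) →L[ℂ] 𝓢(ℂ, ℂ) := SchwartzMap.smulLeftCLM ℂ fun z : ℂ => (z.re : ℂ)

/-- Multiplication by `y`. -/
def mulIm : 𝓢(ℂ, ℂ) →L[ℂ] 𝓢(ℂ, ℂ) := SchwartzMap.smulLeftCLM ℂ fun z : ℂ => (z.im : ℂ)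

/-- `∂_x`. -/
def derivRe : 𝓢(ℂ, ℂ) →L[ℂ] 𝓢(ℂ, ℂ) := lineDerivOpCLM ℂ 𝓢(ℂ, ℂ) (1 : ℂ)

/-- `∂_y`. -/
def derivIm : 𝓢(ℂ, ℂ) →L[ℂ] 𝓢(ℂ, ℂ) := lineDerivOpCLM ℂ 𝓢(ℂ, ℂ) Complex.I

theorem mulRe_apply (f : 𝓢(ℂ, ℂ)) (z : ℂ) : mulRe f z = z.re * f z := by
  simp [mulRe, SchwartzMap.smulLeftCLM_apply_apply hasTemperateGrowth_re]

theorem mulIm_apply (f : 𝓢(ℂ, ℂ)) (z : ℂ) : mulIm f z = z.im * f z := by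
  simp [mulIm, SchwartzMap.smulLeftCLM_apply_apply hasTemperateGrowth_im]

theorem derivRe_apply (f : 𝓢(ℂ, ℂ)) (z : ℂ) : derivRe f z = fderiv ℝ f z 1 := rfl

theorem derivIm_apply (f : 𝓢(ℂ, ℂ)) (z : ℂ) : derivIm f z = fderiv ℝ f z Complex.I := rfl

theorem fderiv_mulRe (f : 𝓢(ℂ, ℂ)) (z w : ℂ) :
    fderiv ℝ (mulRe f) z w = z.re * fderiv ℝ f z w + w.re * f z := by
  have h1 : HasFDerivAt (fun z : ℂ => (z.re : ℂ)) (Complex.ofRealCLM.comp Complex.reCLM) z :=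
    (Complex.ofRealCLM.comp Complex.reCLM).hasFDerivAt
  have h := (h1.mul (f.hasFDerivAt z)).fderiv
  rw [show (mulRe f : ℂ → ℂ) = fun z => (z.re : ℂ) * f z from funext (mulRe_apply f)]
  rw [show (fun z : ℂ => (z.re : ℂ) * f z) = (fun z : ℂ => (z.re : ℂ)) * f from rfl, h]
  simp [mul_comm]

theorem fderiv_mulIm (f : 𝓢(ℂ, ℂ)) (z w : ℂ) :
    fderiv ℝ (mulIm f) z w = z.im * fderiv ℝ f z w + w.im * f z := by
  have h1 : HasFDerivAt (fun z : ℂ => (z.im : ℂ)) (Complex.ofRealCLM.comp Complex.imCLM) z :=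
    (Complex.ofRealCLM.comp Complex.imCLM).hasFDerivAt
  have h := (h1.mul (f.hasFDerivAt z)).fderiv
  rw [show (mulIm f : ℂ → ℂ) = fun z => (z.im : ℂ) * f z from funext (mulIm_apply f)]
  rw [show (fun z : ℂ => (z.im : ℂ) * f z) = (fun z : ℂ => (z.im : ℂ)) * f from rfl, h]
  simp [mul_comm]

/-! ### Canonical commutation relations -/

theorem derivRe_mulRe (f : 𝓢(ℂ, ℂ)) : derivRe (mulRe f) = mulRe (derivRe f) + f := by
  ext z
  simp [derivRe_apply, fderiv_mulRe, mulRe_apply]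

theorem derivRe_mulIm (f : 𝓢(ℂ, ℂ)) : derivRe (mulIm f) = mulIm (derivRe f) := by
  ext z
  simp [derivRe_apply, fderiv_mulIm, mulIm_apply]

theorem derivIm_mulRe (f : 𝓢(ℂ, ℂ)) : derivIm (mulRe f) = mulRe (derivIm f) := by
  ext z
  simp [derivIm_apply, fderiv_mulRe, mulRe_apply]

theorem derivIm_mulIm (f : 𝓢(ℂ, ℂ)) : derivIm (mulIm f) = mulIm (derivIm f) + f := by
  ext z
  simp [derivIm_apply, fderiv_mulIm, mulIm_apply]

theorem mulIm_mulRe (f : 𝓢(ℂ, ℂ)) : mulIm (mulRe f) = mulRe (mulIm f) := by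
  ext z
  simp [mulRe_apply, mulIm_apply]
  ring

theorem derivIm_derivRe (f : 𝓢(ℂ, ℂ)) : derivIm (derivRe f) = derivRe (derivIm f) := by
  ext z
  have hd : DifferentiableAt ℝ (fderiv ℝ f) z :=
    ((f.smooth 2).fderiv_right (m := 1) (by norm_num)).differentiable (by norm_num) z
  have hs : IsSymmSndFDerivAt ℝ f z :=
    (f.contDiffAt 2).isSymmSndFDerivAt (by simp)
  change fderiv ℝ (fun z => fderiv ℝ f z 1) z Complex.I =
    fderiv ℝ (fun z => fderiv ℝ f z Complex.I) z 1
  rw [fderiv_clm_apply hd (by fun_prop), fderiv_clm_apply hd (by fun_prop)]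
  simpa using hs.eq Complex.I 1

/-- `a = z / 2 + ∂_{z̄}`. -/
def lowerA : 𝓢(ℂ, ℂ) →ₗ[ℂ] 𝓢(ℂ, ℂ) :=
  ((1 / 2 : ℂ) • (mulRe + Complex.I • mulIm + derivRe + Complex.I • derivIm) : _ →L[ℂ] _)

/-- `a† = z̄ / 2 - ∂_z`. -/
def raiseA : 𝓢(ℂ, ℂ) →ₗ[ℂ] 𝓢(ℂ, ℂ) :=
  ((1 / 2 : ℂ) • (mulRe - Complex.I • mulIm - derivRe + Complex.I • derivIm) : _ →L[ℂ] _)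

/-- `b = z̄ / 2 + ∂_z`. -/
def lowerB : 𝓢(ℂ, ℂ) →ₗ[ℂ] 𝓢(ℂ, ℂ) :=
  ((1 / 2 : ℂ) • (mulRe - Complex.I • mulIm + derivRe - Complex.I • derivIm) : _ →L[ℂ] _)

/-- `b† = z / 2 - ∂_{z̄}`. -/
def raiseB : 𝓢(ℂ, ℂ) →ₗ[ℂ] 𝓢(ℂ, ℂ) :=
  ((1 / 2 : ℂ) • (mulRe + Complex.I • mulIm - derivRe - Complex.I • derivIm) : _ →L[ℂ] _)

theorem lowerA_apply (f : 𝓢(ℂ, ℂ)) : lowerA f =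
    (1 / 2 : ℂ) • (mulRe f + Complex.I • mulIm f + derivRe f + Complex.I • derivIm f) := rfl

theorem raiseA_apply (f : 𝓢(ℂ, ℂ)) : raiseA f =
    (1 / 2 : ℂ) • (mulRe f - Complex.I • mulIm f - derivRe f + Complex.I • derivIm f) := rfl

theorem lowerB_apply (f : 𝓢(ℂ, ℂ)) : lowerB f =
    (1 / 2 : ℂ) • (mulRe f - Complex.I • mulIm f + derivRe f - Complex.I • derivIm f) := rfl

theorem raiseB_apply (f : 𝓢(ℂ, ℂ)) : raiseB f =
    (1 / 2 : ℂ) • (mulRe f + Complex.I • mulIm f - derivRe f - Complex.I • derivIm f) := rfl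

/-- The canonical commutation relations bring both sides to the same normal order. The a and b pairs
are independent oscillators: a moves between Landau levels, b within one. -/
theorem lowerA_raiseA (f : 𝓢(ℂ, ℂ)) : lowerA (raiseA f) = raiseA (lowerA f) + f := by
  simp only [lowerA_apply, raiseA_apply, map_add, map_sub, map_smul, derivRe_mulRe, derivRe_mulIm,
    derivIm_mulRe, derivIm_mulIm, mulIm_mulRe, derivIm_derivRe]
  match_scalars <;> ring_nf <;> simp <;> norm_num

theorem lowerB_raiseB (f : 𝓢(ℂ, ℂ)) : lowerB (raiseB f) = raiseB (lowerB f) + f := by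
  simp only [lowerB_apply, raiseB_apply, map_add, map_sub, map_smul, derivRe_mulRe, derivRe_mulIm,
    derivIm_mulRe, derivIm_mulIm, mulIm_mulRe, derivIm_derivRe]
  match_scalars <;> ring_nf <;> simp <;> norm_num

theorem lowerA_raiseB (f : 𝓢(ℂ, ℂ)) : lowerA (raiseB f) = raiseB (lowerA f) := by
  simp only [lowerA_apply, raiseB_apply, map_add, map_sub, map_smul, derivRe_mulRe, derivRe_mulIm,
    derivIm_mulRe, derivIm_mulIm, mulIm_mulRe, derivIm_derivRe]
  match_scalars <;> ring_nf <;> simp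

theorem lowerB_raiseA (f : 𝓢(ℂ, ℂ)) : lowerB (raiseA f) = raiseA (lowerB f) := by
  simp only [lowerB_apply, raiseA_apply, map_add, map_sub, map_smul, derivRe_mulRe, derivRe_mulIm,
    derivIm_mulRe, derivIm_mulIm, mulIm_mulRe, derivIm_derivRe]
  match_scalars <;> ring_nf <;> simp

theorem raiseB_raiseA (f : 𝓢(ℂ, ℂ)) : raiseB (raiseA f) = raiseA (raiseB f) := by
  simp only [raiseB_apply, raiseA_apply, map_add, map_sub, map_smul, derivRe_mulRe, derivRe_mulIm,
    derivIm_mulRe, derivIm_mulIm, mulIm_mulRe, derivIm_derivRe]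
  match_scalars <;> ring_nf

theorem fderiv_gaussian (z w : ℂ) :
    fderiv ℝ gaussian z w = -((z.re * w.re + z.im * w.im : ℝ) : ℂ) * gaussian z := by
  have h1 : HasFDerivAt (fun z : ℂ => -(‖z‖ ^ 2 / 2)) (-(innerSL ℝ z)) z := by
    have := (((hasStrictFDerivAt_norm_sq z).hasFDerivAt).const_mul (1 / 2 : ℝ)).neg
    have e : (fun z : ℂ => -(‖z‖ ^ 2 / 2)) = -fun z : ℂ => 1 / 2 * ‖z‖ ^ 2 := by
      funext z
      simp
      ring
    rw [e]
    refine this.congr_fderiv ?_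
    ext w
    simp
    ring
  have h2 := (Complex.ofRealCLM.hasFDerivAt.comp z h1.exp).fderiv
  have h3 : (gaussian : ℂ → ℂ) =
      Complex.ofRealCLM ∘ fun z : ℂ => Real.exp (-(‖z‖ ^ 2 / 2)) := rfl
  rw [h3, h2]
  simp [Complex.inner]
  ring

theorem lowerA_gaussian : lowerA gaussian = 0 := by
  ext z
  simp only [lowerA_apply, _root_.smul_apply, _root_.add_apply, mulRe_apply, mulIm_apply,
    derivRe_apply, derivIm_apply, fderiv_gaussian, smul_eq_mul]
  simp

theorem lowerB_gaussian : lowerB gaussian = 0 := by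
  ext z
  simp only [lowerB_apply, _root_.smul_apply, _root_.add_apply, _root_.sub_apply,
    mulRe_apply, mulIm_apply,
    derivRe_apply, derivIm_apply, fderiv_gaussian, smul_eq_mul]
  simp
  ring

/-! ### The bilinear pairing and the special Hermite functions -/

/-- The bilinear pairing `∫ f φ`. -/
def pair (f φ : 𝓢(ℂ, ℂ)) : ℂ := ∫ z, f z * φ z

theorem pair_eq (f φ : 𝓢(ℂ, ℂ)) : pair f φ = toTemperedDistributionCLM ℂ ℂ volume f φ := by
  simp [pair, mul_comm]

theorem pair_comm (f φ : 𝓢(ℂ, ℂ)) : pair f φ = pair φ f := by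
  simp [pair, mul_comm]

theorem pair_add_right (f φ χ : 𝓢(ℂ, ℂ)) : pair f (φ + χ) = pair f φ + pair f χ := by
  simp only [pair_eq, map_add]

theorem pair_sub_right (f φ χ : 𝓢(ℂ, ℂ)) : pair f (φ - χ) = pair f φ - pair f χ := by
  simp only [pair_eq, map_sub]

theorem pair_smul_right (c : ℂ) (f φ : 𝓢(ℂ, ℂ)) : pair f (c • φ) = c * pair f φ := by
  simp only [pair_eq, map_smul, smul_eq_mul]

theorem pair_add_left (f g φ : 𝓢(ℂ, ℂ)) : pair (f + g) φ = pair f φ + pair g φ := by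
  simp only [pair_comm _ φ, pair_add_right]

theorem pair_sub_left (f g φ : 𝓢(ℂ, ℂ)) : pair (f - g) φ = pair f φ - pair g φ := by
  simp only [pair_comm _ φ, pair_sub_right]

theorem pair_smul_left (c : ℂ) (f φ : 𝓢(ℂ, ℂ)) : pair (c • f) φ = c * pair f φ := by
  simp only [pair_comm _ φ, pair_smul_right]

theorem pair_mulRe (f φ : 𝓢(ℂ, ℂ)) : pair (mulRe f) φ = pair f (mulRe φ) := by
  simp only [pair, mulRe_apply]
  congr 1
  funext z
  ring

theorem pair_mulIm (f φ : 𝓢(ℂ, ℂ)) : pair (mulIm f) φ = pair f (mulIm φ) := by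
  simp only [pair, mulIm_apply]
  congr 1
  funext z
  ring

theorem pair_derivRe (f φ : 𝓢(ℂ, ℂ)) : pair (derivRe f) φ = -pair f (derivRe φ) := by
  have := integral_mul_lineDerivOp_right_eq_neg_left (μ := volume) f φ (1 : ℂ)
  exact (neg_eq_iff_eq_neg.1 this.symm)

theorem pair_derivIm (f φ : 𝓢(ℂ, ℂ)) : pair (derivIm f) φ = -pair f (derivIm φ) := by
  have := integral_mul_lineDerivOp_right_eq_neg_left (μ := volume) f φ Complex.I
  exact (neg_eq_iff_eq_neg.1 this.symm)

/-- For the bilinear pairing multiplications are symmetric and derivatives antisymmetric, so the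
transpose of z/2 + ∂_{z̄} is z/2 - ∂_{z̄}, which is b† and not a†. -/
theorem pair_lowerA (f φ : 𝓢(ℂ, ℂ)) : pair (lowerA f) φ = pair f (raiseB φ) := by
  simp only [lowerA_apply, raiseB_apply, pair_smul_left, pair_add_left, pair_smul_right,
    pair_add_right, pair_sub_right, pair_mulRe, pair_mulIm, pair_derivRe, pair_derivIm]
  ring

theorem pair_lowerB (f φ : 𝓢(ℂ, ℂ)) : pair (lowerB f) φ = pair f (raiseA φ) := by
  simp only [lowerB_apply, raiseA_apply, pair_smul_left, pair_add_left, pair_smul_right,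
    pair_sub_left, pair_add_right, pair_sub_right, pair_mulRe, pair_mulIm, pair_derivRe,
    pair_derivIm]
  ring

/-- The (unnormalized) special Hermite function `(a†)^m (b†)^k e^{-|z|²/2}`. -/
def hermite (m k : ℕ) : 𝓢(ℂ, ℂ) := (raiseA ^ m) ((raiseB ^ k) gaussian)

theorem raiseA_hermite (m k : ℕ) : raiseA (hermite m k) = hermite (m + 1) k := by
  rw [hermite, hermite, pow_succ', Module.End.mul_apply]

theorem raiseB_hermite (m k : ℕ) : raiseB (hermite m k) = hermite m (k + 1) := by
  induction m with
  | zero => rw [hermite, hermite, pow_succ', Module.End.mul_apply]; rfl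
  | succ m ih => rw [← raiseA_hermite, raiseB_raiseA, ih, raiseA_hermite]

theorem lowerA_hermite (m k : ℕ) : lowerA (hermite m k) = (m : ℂ) • hermite (m - 1) k := by
  induction m with
  | zero =>
    induction k with
    | zero => simpa [hermite] using lowerA_gaussian
    | succ k ih => 
      rw [← raiseB_hermite, lowerA_raiseB, ih]
      simp
  | succ m ih =>
    rw [← raiseA_hermite, lowerA_raiseA, ih, map_smul, raiseA_hermite]
    cases m with
    | zero => simp
    | succ m =>
      simp only [Nat.add_sub_cancel]
      push_cast
      module

theorem lowerB_hermite (m k : ℕ) : lowerB (hermite m k) = (k : ℂ) • hermite m (k - 1) := by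
  induction k with
  | zero =>
    induction m with
    | zero => simpa [hermite] using lowerB_gaussian
    | succ m ih =>
      rw [← raiseA_hermite, lowerB_raiseA, ih]
      simp
  | succ k ih =>
    rw [← raiseB_hermite, lowerB_raiseB, ih, map_smul, raiseB_hermite]
    cases k with
    | zero => simp
    | succ k =>
      simp only [Nat.add_sub_cancel]
      push_cast
      module

theorem pair_hermite_zero (k m : ℕ) :
    pair (hermite k m) (hermite 0 0) = if k = 0 ∧ m = 0 then (Real.pi : ℂ) else 0 := by
  cases k with
  | zero =>
    cases m with
    | zero => simpa [pair, hermite] using integral_gaussian_sq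
    | succ m =>
      rw [← raiseB_hermite, pair_comm, ← pair_lowerA, lowerA_hermite]
      simp [pair]
  | succ k =>
    rw [← raiseA_hermite, pair_comm, ← pair_lowerB, lowerB_hermite]
    simp [pair]

/-- Raising operators on the right are moved across as lowering operators until the Gaussian
remains. The index order is crossed because conjugation swaps the two indices (`conj_hermite`), so
this is orthogonality in disguise. -/
theorem pair_hermite (k m m' k' : ℕ) : pair (hermite k m) (hermite m' k') =
    if k = k' ∧ m = m' then (Real.pi * m.factorial * k.factorial : ℂ) else 0 := by
  induction m' generalizing m with
  | zero =>
    induction k' generalizing k with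
    | zero =>
      rw [pair_hermite_zero]
      split_ifs with h
      · simp [h.1, h.2]
      · rfl
    | succ k' ih =>
      rw [← raiseB_hermite, ← pair_lowerA, lowerA_hermite, pair_smul_left, ih]
      cases k with
      | zero => simp
      | succ k => simp [Nat.factorial_succ]; split_ifs <;> ring
  | succ m' ih =>
    rw [← raiseA_hermite, ← pair_lowerB, lowerB_hermite, pair_smul_left, ih]
    cases m with
    | zero => simp
    | succ m => simp [Nat.factorial_succ]; split_ifs <;> ring

theorem fderiv_conj {f h : 𝓢(ℂ, ℂ)} (hf : ∀ z, h z = conj (f z)) (z w : ℂ) :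
    fderiv ℝ h z w = conj (fderiv ℝ f z w) := by
  have h2 := ((Complex.conjCLE : ℂ →L[ℝ] ℂ).hasFDerivAt.comp z (f.hasFDerivAt z)).fderiv
  rw [show (h : ℂ → ℂ) = (Complex.conjCLE : ℂ →L[ℝ] ℂ) ∘ f from funext hf, h2]
  rfl

theorem raiseB_conj {f h : 𝓢(ℂ, ℂ)} (hf : ∀ z, h z = conj (f z)) (z : ℂ) :
    raiseB h z = conj (raiseA f z) := by
  simp only [raiseA_apply, raiseB_apply, _root_.smul_apply, _root_.add_apply, _root_.sub_apply,
    mulRe_apply, mulIm_apply, derivRe_apply, derivIm_apply, fderiv_conj hf, hf, smul_eq_mul]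
  simp [show conj (2 : ℂ) = 2 from map_ofNat _ 2]
  ring

theorem raiseA_conj {f h : 𝓢(ℂ, ℂ)} (hf : ∀ z, h z = conj (f z)) (z : ℂ) :
    raiseA h z = conj (raiseB f z) := by
  have hf' : ∀ z, f z = conj (h z) := fun z => by rw [hf, Complex.conj_conj]
  rw [raiseB_conj hf', Complex.conj_conj]

theorem conj_hermite (m k : ℕ) (z : ℂ) : hermite k m z = conj (hermite m k z) := by
  induction m generalizing z with
  | zero =>
    induction k generalizing z with
    | zero =>
      change gaussian z = conj (gaussian z)
      rw [gaussian_apply, Complex.conj_ofReal]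
    | succ k ih => rw [← raiseA_hermite, ← raiseB_hermite, raiseA_conj ih]
  | succ m ih => rw [← raiseA_hermite, ← raiseB_hermite, raiseB_conj ih]

/-- The normalized special Hermite functions. -/
def landauFun (m k : ℕ) : 𝓢(ℂ, ℂ) :=
  (((√(Real.pi * m.factorial * k.factorial))⁻¹ : ℝ) : ℂ) • hermite m k

theorem conj_landauFun (m k : ℕ) (z : ℂ) : conj (landauFun m k z) = landauFun k m z := by
  simp only [landauFun, _root_.smul_apply, smul_eq_mul, map_mul, Complex.conj_ofReal,
    conj_hermite m k]
  congr 4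
  ring

theorem pair_landauFun (k m m' k' : ℕ) : pair (landauFun k m) (landauFun m' k') =
    if k = k' ∧ m = m' then 1 else 0 := by
  rw [landauFun, landauFun, pair_smul_left, pair_smul_right, pair_hermite]
  split_ifs with h
  · obtain ⟨rfl, rfl⟩ := h
    have hp : 0 < Real.pi * m.factorial * k.factorial := by positivity
    rw [show Real.pi * k.factorial * m.factorial = Real.pi * m.factorial * k.factorial by ring]
    norm_cast
    rw [← mul_assoc, ← mul_inv, Real.mul_self_sqrt hp.le, inv_mul_cancel₀ hp.ne']
  · simp

/-- The special Hermite functions as elements of `L²(ℝ²)`. -/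
def landauVec (p : ℕ × ℕ) : OneBody := (landauFun p.1 p.2).toLp 2

theorem orthonormal_landauVec : Orthonormal ℂ landauVec := by
  rw [orthonormal_iff_ite]
  intro p p'
  refine (inner_toL2_toL2_eq _ _ _).trans ?_
  have h : ∀ z, inner ℂ (landauFun p.1 p.2 z) (landauFun p'.1 p'.2 z) =
      landauFun p.2 p.1 z * landauFun p'.1 p'.2 z := by
    intro z
    rw [RCLike.inner_apply, ← conj_landauFun p.1 p.2, mul_comm]
  simp_rw [h]
  refine (pair_landauFun p.2 p.1 p'.1 p'.2).trans ?_
  congr 1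
  rw [Prod.ext_iff, and_comm]

theorem inner_landauVec (m k : ℕ) (ψ : OneBody) :
    inner ℂ (landauVec (m, k)) ψ = Lp.toTemperedDistribution ψ (landauFun k m) := by
  rw [Lp.toTemperedDistribution_apply, L2.inner_def]
  refine integral_congr_ae ?_
  filter_upwards [(landauFun m k).coeFn_toLp 2 (volume : Measure ℂ)] with z hz
  rw [landauVec, hz, RCLike.inner_apply, ← conj_landauFun m k, smul_eq_mul, mul_comm]

/-! ### Completeness of the special Hermite functions -/

theorem mem_span_hermite (m k : ℕ) :
    hermite m k ∈ Submodule.span ℂ (Set.range fun p : ℕ × ℕ => hermite p.1 p.2) :=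
  Submodule.subset_span ⟨(m, k), rfl⟩

/-- Multiplication by z is a + b† and by z̄ is a† + b, and all four operators preserve the span. -/
theorem mulRe_mulIm_mem_span_hermite {f : 𝓢(ℂ, ℂ)}
    (hf : f ∈ Submodule.span ℂ (Set.range fun p : ℕ × ℕ => hermite p.1 p.2)) :
    mulRe f ∈ Submodule.span ℂ (Set.range fun p : ℕ × ℕ => hermite p.1 p.2) ∧
      mulIm f ∈ Submodule.span ℂ (Set.range fun p : ℕ × ℕ => hermite p.1 p.2) := by
  induction hf using Submodule.span_induction with
  | mem f hf =>
    obtain ⟨⟨m, k⟩, rfl⟩ := hf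
    set P := Submodule.span ℂ (Set.range fun p : ℕ × ℕ => hermite p.1 p.2)
    have h1 : lowerA (hermite m k) ∈ P := by
      rw [lowerA_hermite]; exact P.smul_mem _ (mem_span_hermite _ _)
    have h2 : raiseA (hermite m k) ∈ P := by
      rw [raiseA_hermite]; exact mem_span_hermite _ _
    have h3 : lowerB (hermite m k) ∈ P := by
      rw [lowerB_hermite]; exact P.smul_mem _ (mem_span_hermite _ _)
    have h4 : raiseB (hermite m k) ∈ P := by
      rw [raiseB_hermite]; exact mem_span_hermite _ _
    have e1 : mulRe (hermite m k) = (1 / 2 : ℂ) • ((lowerA (hermite m k) + raiseB (hermite m k)) +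
        (raiseA (hermite m k) + lowerB (hermite m k))) := by
      simp only [lowerA_apply, raiseA_apply, lowerB_apply, raiseB_apply]
      module
    have e2 : mulIm (hermite m k) =
        (-Complex.I / 2) • ((lowerA (hermite m k) + raiseB (hermite m k)) -
        (raiseA (hermite m k) + lowerB (hermite m k))) := by
      simp only [lowerA_apply, raiseA_apply, lowerB_apply, raiseB_apply]
      match_scalars <;> ring_nf <;> simp
    rw [e1, e2]
    exact ⟨P.smul_mem _ (P.add_mem (P.add_mem h1 h4) (P.add_mem h2 h3)),
      P.smul_mem _ (P.sub_mem (P.add_mem h1 h4) (P.add_mem h2 h3))⟩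
  | zero => simp
  | add f g _ _ hf hg =>
    rw [map_add, map_add]
    exact ⟨Submodule.add_mem _ hf.1 hg.1, Submodule.add_mem _ hf.2 hg.2⟩
  | smul c f _ hf =>
    rw [map_smul, map_smul]
    exact ⟨Submodule.smul_mem _ _ hf.1, Submodule.smul_mem _ _ hf.2⟩

/-- The span of the special Hermite functions contains all `⟨z, ξ⟩^j e^{-|z|²/2}`. -/
theorem exists_mem_span_hermite (ξ : ℂ) (j : ℕ) :
    ∃ f ∈ Submodule.span ℂ (Set.range fun p : ℕ × ℕ => hermite p.1 p.2),
      ∀ z, f z = ((inner ℝ z ξ : ℝ) : ℂ) ^ j * gaussian z := by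
  induction j with
  | zero => exact ⟨hermite 0 0, mem_span_hermite 0 0, fun z => by simp [hermite]⟩
  | succ j ih =>
    obtain ⟨f, hf, hfz⟩ := ih
    obtain ⟨h1, h2⟩ := mulRe_mulIm_mem_span_hermite hf
    refine ⟨(ξ.re : ℂ) • mulRe f + (ξ.im : ℂ) • mulIm f,
      Submodule.add_mem _ (Submodule.smul_mem _ _ h1) (Submodule.smul_mem _ _ h2), fun z => ?_⟩
    simp only [_root_.add_apply, _root_.smul_apply, mulRe_apply, mulIm_apply, smul_eq_mul, hfz,
      Complex.inner]
    simp
    ring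

theorem memLp_exp_mul_gaussian (R : ℝ) :
    MemLp (fun z : ℂ => Real.exp (R * ‖z‖) * Real.exp (-(‖z‖ ^ 2 / 2))) 2 volume := by
  have h1 : MemLp (fun z : ℂ => Real.exp (R ^ 2) * Real.exp (-(‖z‖ ^ 2 / 4))) 2 volume := by
    refine MemLp.const_mul ?_ _
    rw [memLp_two_iff_integrable_sq (by fun_prop)]
    refine (realGaussian.integrable (μ := volume)).congr (Filter.Eventually.of_forall fun z => ?_)
    change Real.exp (-(‖z‖ ^ 2 / 2)) = _
    simp only
    rw [← Real.exp_nat_mul]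
    ring_nf
  refine h1.mono (by fun_prop) (Filter.Eventually.of_forall fun z => ?_)
  rw [← Real.exp_add, ← Real.exp_add, Real.norm_eq_abs, Real.norm_eq_abs, Real.abs_exp,
    Real.abs_exp, Real.exp_le_exp]
  -- Expanding (R - |z|/2)² ≥ 0 gives R|z| - |z|²/2 ≤ R² - |z|²/4.
  nlinarith [sq_nonneg (R - ‖z‖ / 2)]

/-- The Fourier transform of `f e^{-|z|²/2}` vanishes if all moments of that function do. -/
theorem fourier_gaussian_mul_eq_zero (f : OneBody)
    (hf : ∀ m k, Lp.toTemperedDistribution f (hermite m k) = 0) (ξ : ℂ) :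
    FourierTransform.fourier (fun z : ℂ => gaussian z * f z) ξ = 0 := by
  have hm : ∀ j : ℕ, ∫ z, ((inner ℝ z ξ : ℝ) : ℂ) ^ j * (gaussian z * f z) = 0 := by
    intro j
    obtain ⟨g, hg, hgz⟩ := exists_mem_span_hermite ξ j
    have h0 : Lp.toTemperedDistribution f g = 0 := by
      clear hgz
      induction hg using Submodule.span_induction with
      | mem g hg => obtain ⟨p, rfl⟩ := hg; exact hf _ _
      | zero => exact map_zero _
      | add g h _ _ hg hh => rw [map_add, hg, hh, add_zero]
      | smul c g _ hg => rw [map_smul, hg, smul_zero]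
    rw [Lp.toTemperedDistribution_apply] at h0
    rw [← h0]
    congr 1
    funext z
    rw [hgz, smul_eq_mul, mul_assoc]
  have hgm : AEStronglyMeasurable (fun z => gaussian z * f z) volume :=
    gaussian.continuous.aestronglyMeasurable.mul (Lp.aestronglyMeasurable f)
  let c : ℂ := -2 * Real.pi * Complex.I
  have hc : ‖c‖ = 2 * Real.pi := by
    simp [c, abs_of_pos Real.pi_pos]
  let F : ℕ → ℂ → ℂ := fun j z => (j.factorial : ℂ)⁻¹ * c ^ j *
    (((inner ℝ z ξ : ℝ) : ℂ) ^ j * (gaussian z * f z))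
  let bd : ℕ → ℂ → ℝ := fun j z => (2 * Real.pi * ‖ξ‖ * ‖z‖) ^ j / j.factorial *
    (Real.exp (-(‖z‖ ^ 2 / 2)) * ‖f z‖)
  have hbd : ∀ z, HasSum (fun j => bd j z)
      (Real.exp (2 * Real.pi * ‖ξ‖ * ‖z‖) * (Real.exp (-(‖z‖ ^ 2 / 2)) * ‖f z‖)) := by
    intro z
    have := NormedSpace.expSeries_div_hasSum_exp (2 * Real.pi * ‖ξ‖ * ‖z‖)
    rw [← Real.exp_eq_exp_ℝ] at this
    exact this.mul_right _
  -- The Fourier character is expanded in its power series and integrated termwise; each term is a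
  -- multiple of a vanishing moment. The majorant e^{2π|ξ||z|} e^{-|z|²/2} |f| is integrable as a
  -- product of two L² functions.
  have key : HasSum (fun j => ∫ z, F j z)
      (∫ z, Complex.exp (c * (inner ℝ z ξ : ℝ)) * (gaussian z * f z)) := by
    refine hasSum_integral_of_dominated_convergence bd (fun j => ?_) (fun j => ?_) ?_ ?_ ?_
    · refine AEStronglyMeasurable.const_mul (AEStronglyMeasurable.mul ?_ hgm) _
      exact Continuous.aestronglyMeasurable (by fun_prop)
    · refine Filter.Eventually.of_forall fun z => ?_
      simp only [F, bd, norm_mul, norm_inv, norm_pow, hc, Complex.norm_natCast, gaussian_apply,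
        Complex.norm_real, Real.norm_eq_abs, Real.abs_exp]
      have h1 : |inner ℝ z ξ| ≤ ‖ξ‖ * ‖z‖ := by
        rw [mul_comm]; exact abs_real_inner_le_norm z ξ
      calc _ = (2 * Real.pi * |inner ℝ z ξ|) ^ j / j.factorial *
            (Real.exp (-(‖z‖ ^ 2 / 2)) * ‖f z‖) := by rw [mul_pow]; ring
        _ ≤ (2 * Real.pi * (‖ξ‖ * ‖z‖)) ^ j / j.factorial *
            (Real.exp (-(‖z‖ ^ 2 / 2)) * ‖f z‖) := by gcongr
        _ = _ := by rw [← mul_assoc (2 * Real.pi)]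
    · exact Filter.Eventually.of_forall fun z => (hbd z).summable
    · simp_rw [fun z => (hbd z).tsum_eq, ← mul_assoc]
      exact (memLp_exp_mul_gaussian (2 * Real.pi * ‖ξ‖)).integrable_mul (Lp.memLp f).norm
    · refine Filter.Eventually.of_forall fun z => ?_
      have := NormedSpace.expSeries_div_hasSum_exp (c * (inner ℝ z ξ : ℝ))
      rw [← Complex.exp_eq_exp_ℂ] at this
      refine (this.mul_right (gaussian z * f z)).congr_fun ?_ 
      intro j
      simp only [F, mul_pow]
      ring
  have h0 : ∀ j, ∫ z, F j z = 0 := by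
    intro j
    simp only [F]
    rw [integral_const_mul, hm, mul_zero]
  simp only [h0] at key
  rw [Real.fourier_eq', ← key.unique hasSum_zero]
  congr 1
  funext z
  rw [smul_eq_mul]
  congr 2
  simp only [c]
  push_cast
  ring

/-- The integrable function e^{-|z|²/2} f has zero Fourier transform. Moving the transform onto
Schwartz functions shows that it is orthogonal to all of them, so it vanishes almost everywhere, and
the Gaussian has no zeros. -/
theorem eq_zero_of_toTemperedDistribution_hermite (f : OneBody)
    (hf : ∀ m k, Lp.toTemperedDistribution f (hermite m k) = 0) : f = 0 := by
  have hint : Integrable (fun z : ℂ => gaussian z * f z) volume :=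
    (gaussian.memLp 2 volume).integrable_mul (Lp.memLp f)
  have h1 : ∀ φ : 𝓢(ℂ, ℂ), ∫ z, φ z * (gaussian z * f z) = 0 := by
    intro φ
    have h := VectorFourier.integral_fourierIntegral_smul_eq_flip (L := innerₗ ℂ)
      Real.continuous_fourierChar continuous_inner
      ((FourierTransformInv.fourierInv φ : 𝓢(ℂ, ℂ)).integrable (μ := volume)) hint
    have e1 : VectorFourier.fourierIntegral Real.fourierChar volume (innerₗ ℂ)
        (FourierTransformInv.fourierInv φ : 𝓢(ℂ, ℂ)) = φ := by
      change FourierTransform.fourier ((FourierTransformInv.fourierInv φ : 𝓢(ℂ, ℂ)) : ℂ → ℂ) = φ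
      rw [← SchwartzMap.fourier_coe, FourierTransform.fourier_fourierInv_eq]
    have e2 : VectorFourier.fourierIntegral Real.fourierChar volume (innerₗ ℂ).flip
        (fun z : ℂ => gaussian z * f z) = 0 := by
      funext ξ
      rw [flip_innerₗ]
      exact fourier_gaussian_mul_eq_zero f hf ξ
    rw [e1, e2] at h
    simpa using h
  have h2 : ∀ᵐ z, gaussian z * f z = 0 := by
    refine ae_eq_zero_of_integral_contDiff_smul_eq_zero hint.locallyIntegrable fun g hg hgc => ?_
    have := h1 ((hgc.comp_left (g := Complex.ofReal) rfl).toSchwartzMap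
      (Complex.ofRealCLM.contDiff.comp hg))
    exact this
  refine (Lp.eq_zero_iff_ae_eq_zero).2 ?_
  filter_upwards [h2] with z hz
  refine (mul_eq_zero.1 hz).resolve_left ?_
  rw [gaussian_apply]
  exact_mod_cast (Real.exp_pos _).ne'

theorem eq_zero_of_inner_landauVec (f : OneBody) (hf : ∀ p, inner ℂ (landauVec p) f = 0) :
    f = 0 := by
  refine eq_zero_of_toTemperedDistribution_hermite f fun m k => ?_
  have h := hf (k, m)
  rw [inner_landauVec, landauFun, map_smul, smul_eq_mul] at h
  refine (mul_eq_zero.1 h).resolve_left ?_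
  norm_cast
  positivity

/-! ### The Landau levels -/

theorem lowering_apply (T : 𝓢'(ℂ, ℂ)) (φ : 𝓢(ℂ, ℂ)) : lowering T φ = T (raiseB φ) := by
  have h : lowering T φ = (1 / 2 : ℂ) *
      (-(-Complex.I * T (-derivIm φ) - T (mulRe φ))
        + Complex.I * (-Complex.I * T (-derivRe φ) + T (mulIm φ))) := rfl
  rw [h, raiseB_apply]
  simp only [map_neg, map_smul, map_add, map_sub, smul_eq_mul]
  ring_nf
  simp
  ring

theorem lowering_pow_apply (n : ℕ) (T : 𝓢'(ℂ, ℂ)) (φ : 𝓢(ℂ, ℂ)) :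
    (lowering ^ n) T φ = T ((raiseB ^ n) φ) := by
  induction n generalizing φ with
  | zero => rfl
  | succ n ih =>
    rw [pow_succ', pow_succ, Module.End.mul_apply, ← ih]
    exact lowering_apply _ _

/-- H = 2a†a + 1 acts on distributions by transposition, and the transpose of a†a is b†b. -/
theorem hamiltonian_apply (T : 𝓢'(ℂ, ℂ)) (φ : 𝓢(ℂ, ℂ)) :
    hamiltonian T φ = T ((2 : ℂ) • raiseB (lowerB φ) + φ) := by
  have hX : ∀ (T : 𝓢'(ℂ, ℂ)) φ, piX T φ = T (Complex.I • derivRe φ + mulIm φ) := by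
    intro T φ
    have h : piX T φ = -Complex.I * T (-derivRe φ) + T (mulIm φ) := rfl
    rw [h]
    simp
  have hY : ∀ (T : 𝓢'(ℂ, ℂ)) φ, piY T φ = T (Complex.I • derivIm φ - mulRe φ) := by
    intro T φ
    have h : piY T φ = -Complex.I * T (-derivIm φ) - T (mulRe φ) := rfl
    rw [h]
    simp
  have h : hamiltonian T φ = (1 / 2 : ℂ) * (piX (piX T) φ + piY (piY T) φ) := rfl
  rw [h, hX, hX, hY, hY, ← map_add, ← smul_eq_mul, ← map_smul]
  congr 1
  simp only [lowerB_apply, raiseB_apply, map_add, map_sub, map_smul, derivRe_mulRe, derivRe_mulIm,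
    derivIm_mulRe, derivIm_mulIm, mulIm_mulRe, derivIm_derivRe]
  match_scalars <;> ring_nf <;> simp <;> ring

theorem mem_landauLevel_iff {n : ℕ} {ψ : OneBody} : ψ ∈ landauLevel n ↔
    hamiltonian (Lp.toTemperedDistribution ψ) = (2 * (n : ℂ) + 1) • Lp.toTemperedDistribution ψ := by
  rw [landauLevel, Submodule.mem_comap, Module.End.mem_eigenspace_iff]
  rfl

theorem raiseB_lowerB_landauFun (k m : ℕ) :
    raiseB (lowerB (landauFun k m)) = (m : ℂ) • landauFun k m := by
  rw [landauFun, map_smul, map_smul, lowerB_hermite, map_smul, raiseB_hermite, smul_comm]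
  cases m with
  | zero => simp
  | succ m => rfl

/-- Orthogonality of eigenvectors in weak form: testing the eigenvalue equation against a Hermite
function avoids any discussion of operator domains. -/
theorem inner_landauVec_of_mem {n m k : ℕ} (hmn : m ≠ n) {ψ : OneBody} (hψ : ψ ∈ landauLevel n) :
    inner ℂ (landauVec (m, k)) ψ = 0 := by
  rw [inner_landauVec]
  have h := congrArg (fun T : 𝓢'(ℂ, ℂ) => T (landauFun k m)) (mem_landauLevel_iff.1 hψ)
  have h2 : hamiltonian (Lp.toTemperedDistribution ψ) (landauFun k m) =
      (2 * (n : ℂ) + 1) * Lp.toTemperedDistribution ψ (landauFun k m) := h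
  rw [hamiltonian_apply, raiseB_lowerB_landauFun, map_add, map_smul, map_smul, smul_eq_mul,
    smul_eq_mul] at h2
  have h3 : (2 * ((m : ℂ) - n)) * Lp.toTemperedDistribution ψ (landauFun k m) = 0 := by
    linear_combination h2
  refine (mul_eq_zero.1 h3).resolve_left ?_
  exact mul_ne_zero two_ne_zero (sub_ne_zero.2 (by exact_mod_cast hmn))

/-- The isometry `ℓ²(ℕ) → L²(ℝ²)` onto the `n`-th Landau level. -/
def levelIsometry (n : ℕ) : lp (fun _ : ℕ => ℂ) 2 →ₗᵢ[ℂ] OneBody :=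
  ((orthonormal_landauVec.comp (fun k => (n, k)) (Prod.mk_right_injective n)).orthogonalFamily).linearIsometry

theorem levelIsometry_single (n k : ℕ) (c : ℂ) :
    levelIsometry n (lp.single 2 k c) = c • landauVec (n, k) :=
  OrthogonalFamily.linearIsometry_apply_single _ _

theorem hasSum_levelIsometry (n : ℕ) (c : lp (fun _ : ℕ => ℂ) 2) :
    HasSum (fun k => c k • landauVec (n, k)) (levelIsometry n c) :=
  OrthogonalFamily.hasSum_linearIsometry _ _

theorem toTemperedDistribution_landauVec (m k : ℕ) (φ : 𝓢(ℂ, ℂ)) :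
    Lp.toTemperedDistribution (landauVec (m, k)) φ = pair (landauFun m k) φ := by
  rw [pair_eq]
  exact congrArg (fun T : 𝓢'(ℂ, ℂ) => T φ) (Lp.toTemperedDistribution_toLp_eq (landauFun m k))

theorem landauVec_mem (n k : ℕ) : landauVec (n, k) ∈ landauLevel n := by
  rw [mem_landauLevel_iff]
  refine DFunLike.ext _ _ fun φ => ?_
  rw [hamiltonian_apply, toTemperedDistribution_landauVec]
  change _ = (2 * (n : ℂ) + 1) * Lp.toTemperedDistribution (landauVec (n, k)) φ
  rw [toTemperedDistribution_landauVec, pair_add_right, pair_smul_right, ← pair_lowerA,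
    pair_comm _ (lowerB φ), pair_lowerB, pair_comm φ]
  have h : raiseA (lowerA (landauFun n k)) = (n : ℂ) • landauFun n k := by
    rw [landauFun, map_smul, map_smul, lowerA_hermite, map_smul, raiseA_hermite, smul_comm]
    cases n with
    | zero => simp
    | succ m => rfl
  rw [h, pair_smul_left]
  ring

theorem lowerA_pow_landauFun (n k : ℕ) :
    (((√(n.factorial : ℝ))⁻¹ : ℝ) : ℂ) • (lowerA ^ n) (landauFun n k) = landauFun 0 k := by
  have h : ∀ n, (lowerA ^ n) (hermite n k) = (n.factorial : ℂ) • hermite 0 k := by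
    intro n
    induction n with
    | zero => simp
    | succ n ih =>
      rw [pow_succ, Module.End.mul_apply, lowerA_hermite, map_smul, Nat.add_sub_cancel, ih,
        smul_smul, Nat.factorial_succ, Nat.cast_mul]
  rw [landauFun, landauFun, map_smul, h, smul_smul, smul_smul]
  congr 1
  have h1 : (n.factorial : ℂ) = ((√(n.factorial : ℝ) * √(n.factorial : ℝ) : ℝ) : ℂ) := by
    rw [Real.mul_self_sqrt (by positivity)]; simp
  rw [h1, ← Complex.ofReal_mul, ← Complex.ofReal_mul,
    show Real.pi * n.factorial * k.factorial = n.factorial * (Real.pi * k.factorial) by ring,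
    Real.sqrt_mul (by positivity)]
  have : √(n.factorial : ℝ) ≠ 0 := by positivity
  congr 1
  simp only [Nat.factorial_zero, Nat.cast_one, mul_one, mul_inv]
  field_simp

theorem pair_lowerA_pow (n : ℕ) (f φ : 𝓢(ℂ, ℂ)) :
    pair ((lowerA ^ n) f) φ = pair f ((raiseB ^ n) φ) := by
  induction n generalizing f φ with
  | zero => rfl
  | succ n ih =>
    rw [pow_succ', pow_succ, Module.End.mul_apply, Module.End.mul_apply, pair_lowerA, ih]

theorem levelIsometry_mem (n : ℕ) (c : lp (fun _ : ℕ => ℂ) 2) :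
    levelIsometry n c ∈ landauLevel n := by
  let J : lp (fun _ : ℕ => ℂ) 2 →L[ℂ] 𝓢'(ℂ, ℂ) :=
    (Lp.toTemperedDistributionCLM ℂ volume 2).comp (levelIsometry n).toContinuousLinearMap
  -- Both sides are continuous and linear in c, so it suffices to compare them on unit vectors.
  have h : hamiltonian.comp J = (2 * (n : ℂ) + 1) • J := by
    refine lp.ext_continuousLinearMap (by simp) fun k => ContinuousLinearMap.ext_ring ?_
    change hamiltonian (Lp.toTemperedDistribution (levelIsometry n (lp.single 2 k 1))) =
      (2 * (n : ℂ) + 1) • Lp.toTemperedDistribution (levelIsometry n (lp.single 2 k 1))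
    rw [levelIsometry_single, one_smul]
    exact mem_landauLevel_iff.1 (landauVec_mem n k)
  exact mem_landauLevel_iff.2 (congrArg (fun L : lp (fun _ : ℕ => ℂ) 2 →L[ℂ] 𝓢'(ℂ, ℂ) => L c) h)

theorem isLevelLowering_levelIsometry (n : ℕ) (c : lp (fun _ : ℕ => ℂ) 2) :
    IsLevelLowering n (levelIsometry n c) (levelIsometry 0 c) := by
  refine ⟨levelIsometry_mem n c, ?_⟩
  let J : ℕ → lp (fun _ : ℕ => ℂ) 2 →L[ℂ] 𝓢'(ℂ, ℂ) := fun n =>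
    (Lp.toTemperedDistributionCLM ℂ volume 2).comp (levelIsometry n).toContinuousLinearMap
  have h : (((√(n.factorial : ℝ))⁻¹ : ℝ) : ℂ) • (lowering ^ n).comp (J n) = J 0 := by
    refine lp.ext_continuousLinearMap (by simp) fun k => ContinuousLinearMap.ext_ring ?_
    change (((√(n.factorial : ℝ))⁻¹ : ℝ) : ℂ) •
      (lowering ^ n) (Lp.toTemperedDistribution (levelIsometry n (lp.single 2 k 1))) =
      Lp.toTemperedDistribution (levelIsometry 0 (lp.single 2 k 1))
    rw [levelIsometry_single, levelIsometry_single, one_smul, one_smul]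
    refine DFunLike.ext _ _ fun φ => ?_
    change (((√(n.factorial : ℝ))⁻¹ : ℝ) : ℂ) *
      (lowering ^ n) (Lp.toTemperedDistribution (landauVec (n, k))) φ = _
    rw [lowering_pow_apply, toTemperedDistribution_landauVec, toTemperedDistribution_landauVec,
      ← pair_lowerA_pow, ← pair_smul_left, lowerA_pow_landauFun]
  exact congrArg (fun L : lp (fun _ : ℕ => ℂ) 2 →L[ℂ] 𝓢'(ℂ, ℂ) => L c) h

/-- The difference between ψ and its projection to the closed span of `landauVec (n, ·)` is
orthogonal to every `landauVec`, hence zero by completeness. -/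
theorem exists_eq_levelIsometry {n : ℕ} {ψ : OneBody} (hψ : ψ ∈ landauLevel n) :
    ∃ c, ψ = levelIsometry n c := by
  let W := (levelIsometry n).toContinuousLinearMap
  refine ⟨W.adjoint ψ, sub_eq_zero.1 (eq_zero_of_inner_landauVec _ fun p => ?_)⟩
  obtain ⟨m, k⟩ := p
  by_cases hmn : m = n
  · subst hmn
    have h : landauVec (m, k) = W (lp.single 2 k 1) := by
      change _ = levelIsometry m _
      rw [levelIsometry_single, one_smul]
    rw [inner_sub_right, h, ← ContinuousLinearMap.adjoint_inner_right W _ ψ]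
    change _ - inner ℂ (levelIsometry m _) (levelIsometry m _) = _
    rw [LinearIsometry.inner_map_map, sub_self]
  · rw [inner_sub_right, inner_landauVec_of_mem hmn hψ,
      inner_landauVec_of_mem hmn (levelIsometry_mem n _), sub_self]

theorem IsLevelLowering.exists_eq {n : ℕ} {ψ χ : OneBody} (h : IsLevelLowering n ψ χ) :
    ∃ c, ψ = levelIsometry n c ∧ χ = levelIsometry 0 c := by
  obtain ⟨c, rfl⟩ := exists_eq_levelIsometry h.1
  refine ⟨c, rfl, ?_⟩
  have h2 := h.2.symm.trans (isLevelLowering_levelIsometry n c).2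
  exact (LinearMap.ker_eq_bot.1
    (Lp.ker_toTemperedDistributionCLM_eq_bot (F := ℂ) (μ := (volume : Measure ℂ)) (p := 2))) h2

theorem IsLevelLowering.inner_eq {n : ℕ} {ψ χ ψ' χ' : OneBody} (h : IsLevelLowering n ψ χ)
    (h' : IsLevelLowering n ψ' χ') : inner ℂ ψ ψ' = inner ℂ χ χ' := by
  obtain ⟨c, rfl, rfl⟩ := h.exists_eq
  obtain ⟨c', rfl, rfl⟩ := h'.exists_eq
  rw [LinearIsometry.inner_map_map, LinearIsometry.inner_map_map]

theorem IsLevelLowering.mem_zero {n : ℕ} {ψ χ : OneBody} (h : IsLevelLowering n ψ χ) :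
    χ ∈ landauLevel 0 := by
  obtain ⟨c, rfl, rfl⟩ := h.exists_eq
  exact levelIsometry_mem 0 c

theorem exists_isLevelLowering {n : ℕ} {ψ : OneBody} (hψ : ψ ∈ landauLevel n) :
    ∃ χ, IsLevelLowering n ψ χ := by
  obtain ⟨c, rfl⟩ := exists_eq_levelIsometry hψ
  exact ⟨_, isLevelLowering_levelIsometry n c⟩

theorem exists_isLevelLowering_of_mem_zero (n : ℕ) {χ : OneBody} (hχ : χ ∈ landauLevel 0) :
    ∃ ψ, IsLevelLowering n ψ χ := by
  obtain ⟨c, rfl⟩ := exists_eq_levelIsometry hχ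
  exact ⟨_, isLevelLowering_levelIsometry n c⟩

/-! ### Reproducing kernels -/

section KernelGraph

variable {α H : Type*} [MeasurableSpace α] {μ : Measure α} [NormedAddCommGroup H]
  [InnerProductSpace ℂ H]

/-- The pairs `(f, v)` such that `f` is represented by the function `r ↦ ⟪K r, v⟫`. -/
def kernelGraph (μ : Measure α) (K : α → H) : Submodule ℂ (Lp ℂ 2 μ × H) where
  carrier := {P | P.1 =ᵐ[μ] fun r => inner ℂ (K r) P.2}
  zero_mem' := by
    filter_upwards [Lp.coeFn_zero ℂ 2 μ] with r hr
    simpa using hr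
  add_mem' := by
    intro P Q hP hQ
    filter_upwards [hP, hQ, Lp.coeFn_add P.1 Q.1] with r h1 h2 h3
    rw [Prod.fst_add, Prod.snd_add, h3, Pi.add_apply, h1, h2, inner_add_right]
  smul_mem' := by
    intro c P hP
    filter_upwards [hP, Lp.coeFn_smul c P.1] with r h1 h2
    rw [Prod.smul_fst, Prod.smul_snd, h2, Pi.smul_apply, h1, inner_smul_right, smul_eq_mul]

theorem mem_kernelGraph {K : α → H} {P : Lp ℂ 2 μ × H} :
    P ∈ kernelGraph μ K ↔ P.1 =ᵐ[μ] fun r => inner ℂ (K r) P.2 := Iff.rfl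

/-- An L²-convergent sequence has an almost everywhere convergent subsequence, while the inner
products with K r converge at every r. This carries kernel representations from generators to closed
spans. -/
theorem isClosed_kernelGraph (K : α → H) : IsClosed (kernelGraph μ K : Set (Lp ℂ 2 μ × H)) := by
  refine IsSeqClosed.isClosed fun P Q hP hPQ => ?_
  have h1 : Filter.Tendsto (fun n => (P n).1) Filter.atTop (nhds Q.1) :=
    (continuous_fst.tendsto Q).comp hPQ
  have h2 : Filter.Tendsto (fun n => (P n).2) Filter.atTop (nhds Q.2) :=
    (continuous_snd.tendsto Q).comp hPQ
  obtain ⟨ns, hns, hae⟩ := (tendstoInMeasure_of_tendsto_Lp h1).exists_seq_tendsto_ae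
  have hall : ∀ᵐ r ∂μ, ∀ n, (P n).1 r = inner ℂ (K r) (P n).2 := ae_all_iff.2 hP
  refine mem_kernelGraph.2 ?_
  filter_upwards [hae, hall] with r hr hr'
  have h3 : Filter.Tendsto (fun i => inner ℂ (K r) (P (ns i)).2) Filter.atTop
      (nhds (inner ℂ (K r) Q.2)) :=
    ((continuous_const.inner continuous_id).tendsto Q.2).comp (h2.comp hns.tendsto_atTop)
  refine tendsto_nhds_unique hr (h3.congr fun i => (hr' _).symm)

end KernelGraph

theorem summable_pow_div_sqrt_factorial {R : ℝ} (hR : 0 ≤ R) :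
    Summable fun k : ℕ => R ^ k / √(k.factorial : ℝ) := by
  have h1 : Summable fun k : ℕ => (2 * R ^ 2) ^ k / (k.factorial : ℝ) :=
    Real.summable_pow_div_factorial _
  have h2 : Summable fun k : ℕ => (1 / 2 : ℝ) ^ k := summable_geometric_two
  refine Summable.of_nonneg_of_le (fun k => by positivity) (fun k => ?_) (h1.add h2)
  set x := R ^ k / √(k.factorial : ℝ) with hx
  have hx0 : 0 ≤ x := by positivity
  have hx2 : (2 * R ^ 2) ^ k / (k.factorial : ℝ) = x ^ 2 * 2 ^ k := by
    rw [hx, div_pow, Real.sq_sqrt (by positivity), mul_pow]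
    ring
  have hs : (0 : ℝ) < 2 ^ k := by positivity
  rw [hx2, one_div, inv_pow]
  -- The inequality 2x ≤ x² 2^k + 2^{-k} trades the square root of the factorial for an exponential
  -- and a geometric series.
  have h3 : x ^ 2 * 2 ^ k + (2 ^ k : ℝ)⁻¹ - 2 * x = (x * 2 ^ k - 1) ^ 2 * (2 ^ k : ℝ)⁻¹ := by
    field_simp
    ring
  have h4 : 0 ≤ (x * 2 ^ k - 1) ^ 2 * (2 ^ k : ℝ)⁻¹ := by positivity
  linarith

theorem hasFDerivAt_gaussian (z : ℂ) : HasFDerivAt gaussian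
    (wirtinger (-(conj z / 2) * gaussian z) (-(z / 2) * gaussian z)) z := by
  refine (gaussian.hasFDerivAt z).congr_fderiv (ContinuousLinearMap.ext fun w => ?_)
  rw [fderiv_gaussian, wirtinger_apply]
  have : ((z.re * w.re + z.im * w.im : ℝ) : ℂ) = (w * conj z + conj w * z) / 2 := by
    apply Complex.ext <;> simp <;> ring
  rw [this]
  simp only [smul_eq_mul]
  ring

theorem sqrt_mul_inv_sqrt_factorial (n : ℕ) :
    √(n + 1 : ℝ) * (√(Real.pi * (n + 1).factorial))⁻¹ = (√(Real.pi * n.factorial))⁻¹ := by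
  rw [Nat.factorial_succ, Nat.cast_mul, Nat.cast_succ,
    show Real.pi * ((n + 1 : ℝ) * n.factorial) = (n + 1) * (Real.pi * n.factorial) by ring,
    Real.sqrt_mul (by positivity)]
  have : √(n + 1 : ℝ) ≠ 0 := by positivity
  field_simp

/-! ### Coherent states and the kernels raised from them -/

section Coherent

variable {V : Type*} [NormedAddCommGroup V] [InnerProductSpace ℂ V]

/-- The unnormalized coherent state `∑ t^k / √k! e_k`. -/
def coherent (e : ℕ → V) (t : ℂ) : V := ∑' k : ℕ, (t ^ k / (√(k.factorial : ℝ) : ℂ)) • e k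

variable {e : ℕ → V}

theorem norm_coherent_term (he : Orthonormal ℂ e) (t : ℂ) (k : ℕ) :
    ‖(t ^ k / (√(k.factorial : ℝ) : ℂ)) • e k‖ = ‖t‖ ^ k / √(k.factorial : ℝ) := by
  rw [norm_smul, he.1, mul_one, norm_div, norm_pow, Complex.norm_real,
    Real.norm_of_nonneg (Real.sqrt_nonneg _)]

variable [CompleteSpace V]

theorem hasSum_coherent (he : Orthonormal ℂ e) (t : ℂ) :
    HasSum (fun k : ℕ => (t ^ k / (√(k.factorial : ℝ) : ℂ)) • e k) (coherent e t) := by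
  refine Summable.hasSum (Summable.of_norm ?_)
  simp_rw [norm_coherent_term he]
  exact summable_pow_div_sqrt_factorial (norm_nonneg t)

theorem inner_coherent (he : Orthonormal ℂ e) (t : ℂ) (k : ℕ) :
    inner ℂ (e k) (coherent e t) = t ^ k / (√(k.factorial : ℝ) : ℂ) := by
  have h := (hasSum_coherent he t).mapL (innerSL ℂ (e k))
  refine h.unique ?_
  have h2 : ∀ j, innerSL ℂ (e k) ((t ^ j / (√(j.factorial : ℝ) : ℂ)) • e j)
      = if j = k then t ^ k / (√(k.factorial : ℝ) : ℂ) else 0 := by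
    intro j
    rw [innerSL_apply_apply, inner_smul_right, orthonormal_iff_ite.1 he]
    by_cases hjk : j = k
    · simp [hjk]
    · simp [hjk, Ne.symm hjk]
  simp_rw [h2]
  exact hasSum_ite_eq _ _

theorem differentiable_coherent (he : Orthonormal ℂ e) : Differentiable ℂ (coherent e) := by
  intro t
  have h := Complex.differentiableOn_tsum_of_summable_norm
    (F := fun (k : ℕ) (t : ℂ) => (t ^ k / (√(k.factorial : ℝ) : ℂ)) • e k)
    (summable_pow_div_sqrt_factorial (by positivity : 0 ≤ ‖t‖ + 1))
    (fun k => by fun_prop) (Metric.isOpen_ball (x := (0 : ℂ)) (ε := ‖t‖ + 1)) (fun k w hw => by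
      rw [norm_coherent_term he]
      rw [mem_ball_zero_iff] at hw
      gcongr)
  exact h.differentiableAt (Metric.isOpen_ball.mem_nhds (by simp))

theorem hasDerivAt_iteratedDeriv_coherent (he : Orthonormal ℂ e) (j : ℕ) (t : ℂ) :
    HasDerivAt (iteratedDeriv j (coherent e)) (iteratedDeriv (j + 1) (coherent e) t) t := by
  rw [iteratedDeriv_succ]
  exact (((differentiable_coherent he).contDiff (n := j + 1)).differentiable_iteratedDeriv j
    (by exact_mod_cast Nat.lt_succ_self j) t).hasDerivAt

/-- `(z - ∂_t)^n ∂_t^j` applied to the coherent state, at `t = z̄`. -/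
def raisedCoherent (e : ℕ → V) : ℕ → ℕ → ℂ → V
  | 0, j, z => iteratedDeriv j (coherent e) (conj z)
  | n + 1, j, z => z • raisedCoherent e n j z - raisedCoherent e n (j + 1) z

/-- The coherent state is holomorphic in t = z̄, so ∂_{z̄} acts as ∂_t, and ∂_z sees only the
explicit factors z - ∂_t. -/
theorem hasFDerivAt_raisedCoherent (he : Orthonormal ℂ e) (n j : ℕ) (z : ℂ) :
    HasFDerivAt (raisedCoherent e n j)
      (wirtinger ((n : ℂ) • raisedCoherent e (n - 1) j z) (raisedCoherent e n (j + 1) z)) z := by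
  induction n generalizing j with
  | zero =>
    have h := (hasDerivAt_iteratedDeriv_coherent he j (conj z)).hasFDerivAt.restrictScalars ℝ
    refine (h.comp z (Complex.conjCLE : ℂ →L[ℝ] ℂ).hasFDerivAt).congr_fderiv ?_
    refine ContinuousLinearMap.ext fun w => ?_
    rw [wirtinger_apply]
    simp [raisedCoherent]
  | succ n ih =>
    refine (((hasFDerivAt_id z).smul (ih j)).sub (ih (j + 1))).congr_fderiv ?_
    refine ContinuousLinearMap.ext fun w => ?_
    have h : (n : ℂ) • raisedCoherent e n j z = (n : ℂ) • (z • raisedCoherent e (n - 1) j z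
        - raisedCoherent e (n - 1) (j + 1) z) := by
      cases n with
      | zero => simp
      | succ n => rfl
    simp only [raisedCoherent, _root_.sub_apply, _root_.add_apply,
      _root_.smul_apply, ContinuousLinearMap.smulRight_apply, wirtinger_apply, id,
      ContinuousLinearMap.id_apply, Nat.add_sub_cancel, Nat.cast_succ, add_smul, h]
    module

/-- The functions `(π n!)^{-1/2} e^{-|z|²/2} (z - ∂_t)^n ∑_k t^k / √k! e_k` at `t = z̄`. -/
def coherentKernel (e : ℕ → V) (n : ℕ) (z : ℂ) : V :=
  ((((√(Real.pi * n.factorial))⁻¹ : ℝ) : ℂ) * gaussian z) • raisedCoherent e n 0 z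

/-- The Gaussian contributes -z̄/2 and -z/2. Writing ∂_t as z - (z - ∂_t) turns the latter into z/2
and produces the next rung; the normalization turns the factor n into √n. -/
theorem isConjLadder_coherentKernel (he : Orthonormal ℂ e) : IsConjLadder (coherentKernel e) := by
  intro n z
  refine (((hasFDerivAt_gaussian z).const_mul (((√(Real.pi * n.factorial))⁻¹ : ℝ) : ℂ)).smul
    (hasFDerivAt_raisedCoherent he n 0 z)).congr_fderiv (ContinuousLinearMap.ext fun w => ?_)
  have h1 : (√(n : ℝ) : ℂ) • coherentKernel e (n - 1) z =
      ((((√(Real.pi * n.factorial))⁻¹ : ℝ) : ℂ) * gaussian z) •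
        ((n : ℂ) • raisedCoherent e (n - 1) 0 z) := by
    cases n with
    | zero => simp
    | succ n =>
      have h : ((n + 1 : ℕ) : ℂ) = ((√(n + 1 : ℝ) * √(n + 1 : ℝ) : ℝ) : ℂ) := by
        rw [Real.mul_self_sqrt (by positivity)]; simp
      rw [Nat.add_sub_cancel, coherentKernel, ← sqrt_mul_inv_sqrt_factorial n, h, Nat.cast_succ]
      push_cast
      module
  have h2 : (√(n + 1 : ℝ) : ℂ) • coherentKernel e (n + 1) z =
      ((((√(Real.pi * n.factorial))⁻¹ : ℝ) : ℂ) * gaussian z) •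
        (z • raisedCoherent e n 0 z - raisedCoherent e n 1 z) := by
    rw [coherentKernel, ← sqrt_mul_inv_sqrt_factorial n, raisedCoherent]
    push_cast
    module
  rw [h1, h2, coherentKernel]
  simp only [_root_.add_apply, _root_.smul_apply,
    ContinuousLinearMap.smulRight_apply, wirtinger_apply, smul_eq_mul]
  module

end Coherent

/-- The reproducing kernel of the `n`-th Landau level, transported to the lowest Landau level. -/
def landauKernel (n : ℕ) (z : ℂ) : OneBody := coherentKernel (fun k => landauVec (0, k)) n z

theorem orthonormal_landauVec_zero : Orthonormal ℂ fun k => landauVec (0, k) :=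
  orthonormal_landauVec.comp (fun k => (0, k)) (Prod.mk_right_injective 0)

theorem isConjLadder_landauKernel : IsConjLadder landauKernel :=
  isConjLadder_coherentKernel orthonormal_landauVec_zero

theorem raiseB_add_lowerA (f : 𝓢(ℂ, ℂ)) (z : ℂ) : raiseB f z + lowerA f z = z * f z := by
  simp only [raiseB_apply, lowerA_apply, _root_.smul_apply, _root_.add_apply, _root_.sub_apply,
    mulRe_apply, mulIm_apply, smul_eq_mul]
  linear_combination f z * Complex.re_add_im z

theorem hermite_zero_apply (k : ℕ) (z : ℂ) : hermite 0 k z = z ^ k * gaussian z := by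
  induction k with
  | zero => simp [hermite]
  | succ k ih =>
    have h := raiseB_add_lowerA (hermite 0 k) z
    rw [lowerA_hermite, raiseB_hermite, ih] at h
    simp only [Nat.cast_zero, zero_smul, _root_.zero_apply, add_zero] at h
    rw [h]
    ring

theorem raiseA_landauFun (n k : ℕ) :
    raiseA (landauFun n k) = (√(n + 1 : ℝ) : ℂ) • landauFun (n + 1) k := by
  rw [landauFun, landauFun, map_smul, raiseA_hermite, smul_smul, ← Complex.ofReal_mul]
  congr 2
  rw [Nat.factorial_succ, Nat.cast_mul, Nat.cast_succ,
    show Real.pi * ((n + 1 : ℝ) * n.factorial) * k.factorial =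
      (n + 1) * (Real.pi * n.factorial * k.factorial) by ring,
    Real.sqrt_mul (by positivity : (0 : ℝ) ≤ n + 1)]
  have : √(n + 1 : ℝ) ≠ 0 := by positivity
  rw [mul_inv, mul_inv_cancel_left₀ this]

/-- At n = 0 this reads off a coefficient of the coherent state. Then both sides climb by a†/√(n+1):
the left by the ladder relation, the right by `raiseA_landauFun`. -/
theorem inner_landauKernel_landauVec (n k : ℕ) (z : ℂ) :
    inner ℂ (landauKernel n z) (landauVec (0, k)) = landauFun n k z := by
  induction n generalizing z with
  | zero =>
    rw [← inner_conj_symm, landauKernel, coherentKernel, inner_smul_right]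
    simp only [raisedCoherent, iteratedDeriv_zero]
    rw [inner_coherent orthonormal_landauVec_zero, landauFun, _root_.smul_apply, hermite_zero_apply]
    simp only [map_mul, map_div₀, map_pow, Complex.conj_ofReal, Complex.conj_conj, gaussian_apply,
      smul_eq_mul, Nat.factorial_zero, Nat.cast_one, mul_one]
    rw [Real.sqrt_mul Real.pi_pos.le, mul_inv, Complex.ofReal_mul, Complex.ofReal_inv (√(k.factorial : ℝ))]
    ring
  | succ n ih =>
    have h := (isConjLadder_landauKernel.map (innerSLFlip ℂ (landauVec (0, k)))) n z
    have hf : (fun z => innerSLFlip ℂ (landauVec (0, k)) (landauKernel n z)) = landauFun n k :=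
      funext fun z => ih z
    beta_reduce at h
    rw [hf] at h
    have h1 := derivRe_apply (landauFun n k) z
    have h2 := derivIm_apply (landauFun n k) z
    rw [h.fderiv, wirtinger_apply] at h1 h2
    have h3 := congrArg (fun f : 𝓢(ℂ, ℂ) => f z) (raiseA_landauFun n k)
    simp only [raiseA_apply, _root_.smul_apply, _root_.add_apply, _root_.sub_apply, mulRe_apply,
      mulIm_apply, h1, h2, smul_eq_mul, map_one, Complex.conj_I, one_mul] at h3
    simp only [innerSLFlip_apply_apply, ih] at h3
    have hs : (√(n + 1 : ℝ) : ℂ) ≠ 0 := by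
      have : √(n + 1 : ℝ) ≠ 0 := by positivity
      exact_mod_cast this
    refine mul_left_cancel₀ hs (Eq.trans ?_ h3)
    have hz : conj z = z.re - Complex.I * z.im := by
      apply Complex.ext <;> simp
    rw [hz]
    ring_nf
    simp only [Complex.I_sq, Complex.I_pow_three]
    ring

/-- A function in the `n`-th Landau level is represented by the reproducing kernel. -/
theorem IsLevelLowering.ae_eq {n : ℕ} {ψ χ : OneBody} (h : IsLevelLowering n ψ χ) :
    ψ =ᵐ[volume] fun z => inner ℂ (landauKernel n z) χ := by
  obtain ⟨c, rfl, rfl⟩ := h.exists_eq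
  have hs := (hasSum_levelIsometry n c).prodMk (hasSum_levelIsometry 0 c)
  have hmem : (levelIsometry n c, levelIsometry 0 c) ∈ kernelGraph volume (landauKernel n) := by
    refine (isClosed_kernelGraph (landauKernel n)).mem_of_tendsto hs
      (Filter.Eventually.of_forall fun s => Submodule.sum_mem _ fun k _ => ?_)
    refine Submodule.smul_mem (kernelGraph volume (landauKernel n)) (c k)
      (x := (landauVec (n, k), landauVec (0, k))) ?_
    rw [mem_kernelGraph]
    simp only [inner_landauKernel_landauVec]
    exact (landauFun n k).coeFn_toLp 2 volume
  exact hmem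

/-! ### Product states -/

variable {N : ℕ}

theorem coeFn_tensor (ψ : Fin N → OneBody) :
    tensor ψ =ᵐ[volume] fun r => ∏ i, ψ i (r i) :=
  (memLp_tensor ψ).coeFn_toLp

theorem ae_forall_eval {p : Fin N → ℂ → Prop} (hp : ∀ i, ∀ᵐ z : ℂ, p i z) :
    ∀ᵐ r : Fin N → ℂ, ∀ i, p i (r i) :=
  ae_all_iff.2 fun i =>
    (Measure.quasiMeasurePreserving_eval (fun _ : Fin N => (volume : Measure ℂ)) i).ae (hp i)

theorem inner_tensor (ψ χ : Fin N → OneBody) :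
    inner ℂ (tensor ψ) (tensor χ) = ∏ i, inner ℂ (ψ i) (χ i) := by
  simp only [L2.inner_def]
  rw [← integral_fintype_prod_volume_eq_prod (fun i z => inner ℂ (ψ i z) (χ i z))]
  refine integral_congr_ae ?_
  filter_upwards [coeFn_tensor ψ, coeFn_tensor χ] with r h1 h2
  simp only [h1, h2, RCLike.inner_apply, map_prod, Finset.prod_mul_distrib]

theorem norm_tensor (ψ : Fin N → OneBody) : ‖tensor ψ‖ = ∏ i, ‖ψ i‖ := by
  have h := inner_tensor ψ ψ
  simp only [inner_self_eq_norm_sq_to_K, Finset.prod_pow] at h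
  have h2 : ‖tensor ψ‖ ^ 2 = (∏ i, ‖ψ i‖) ^ 2 := by exact_mod_cast h
  exact (sq_eq_sq₀ (norm_nonneg _) (Finset.prod_nonneg fun _ _ => norm_nonneg _)).1 h2

theorem tensor_update_add [DecidableEq (Fin N)] (ψ : Fin N → OneBody) (i : Fin N) (x y : OneBody) :
    tensor (Function.update ψ i (x + y)) =
      tensor (Function.update ψ i x) + tensor (Function.update ψ i y) := by
  refine Lp.ext ?_
  filter_upwards [coeFn_tensor (Function.update ψ i (x + y)), coeFn_tensor (Function.update ψ i x),
    coeFn_tensor (Function.update ψ i y), Lp.coeFn_add (tensor (Function.update ψ i x))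
      (tensor (Function.update ψ i y)), ae_forall_eval fun _ => Lp.coeFn_add x y]
    with r h1 h2 h3 h4 h5
  rw [h4, Pi.add_apply, h1, h2, h3]
  simp only [← Finset.mul_prod_erase _ _ (Finset.mem_univ i), Function.update_self, h5,
    Pi.add_apply, add_mul]
  congr 2 <;> refine Finset.prod_congr rfl fun j hj => ?_ <;>
    simp [Function.update_of_ne (Finset.ne_of_mem_erase hj)]

theorem tensor_update_smul [DecidableEq (Fin N)] (ψ : Fin N → OneBody) (i : Fin N) (c : ℂ)
    (x : OneBody) :
    tensor (Function.update ψ i (c • x)) = c • tensor (Function.update ψ i x) := by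
  refine Lp.ext ?_
  filter_upwards [coeFn_tensor (Function.update ψ i (c • x)), coeFn_tensor (Function.update ψ i x),
    Lp.coeFn_smul c (tensor (Function.update ψ i x)), ae_forall_eval fun _ => Lp.coeFn_smul c x]
    with r h1 h2 h3 h4
  rw [h3, Pi.smul_apply, h1, h2]
  simp only [← Finset.mul_prod_erase _ _ (Finset.mem_univ i), Function.update_self, h4,
    Pi.smul_apply, smul_eq_mul, mul_assoc]
  congr 2
  refine Finset.prod_congr rfl fun j hj => ?_
  simp [Function.update_of_ne (Finset.ne_of_mem_erase hj)]

/-- The formation of product states as a continuous multilinear map. -/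
def tensorMap (N : ℕ) : ContinuousMultilinearMap ℂ (fun _ : Fin N => OneBody) (ManyBody N) :=
  MultilinearMap.mkContinuous
    { toFun := tensor
      map_update_add' := tensor_update_add
      map_update_smul' := tensor_update_smul } 1 fun ψ => by
    change ‖tensor ψ‖ ≤ _
    rw [norm_tensor, one_mul]

theorem tensorMap_apply (ψ : Fin N → OneBody) : tensorMap N ψ = tensor ψ := rfl

theorem tensor_comp_perm (σ : Equiv.Perm (Fin N)) (ψ : Fin N → OneBody) :
    Lp.compMeasurePreserving _ (measurePreserving_perm σ) (tensor ψ) = tensor (ψ ∘ σ.symm) := by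
  refine Lp.ext ?_
  filter_upwards [Lp.coeFn_compMeasurePreserving (tensor ψ) (measurePreserving_perm σ),
    (measurePreserving_perm σ).quasiMeasurePreserving.ae (coeFn_tensor ψ),
    coeFn_tensor (ψ ∘ σ.symm)] with r h1 h2 h3
  rw [h1, Function.comp_apply, h2, h3, ← Equiv.prod_comp σ fun i => (ψ ∘ σ.symm) i (r i)]
  simp

/-! ### Closures of inner-product preserving relations -/

section Relation

variable {X Y Z : Type*} [NormedAddCommGroup X] [InnerProductSpace ℂ X] [NormedAddCommGroup Y]
  [InnerProductSpace ℂ Y] [NormedAddCommGroup Z] [InnerProductSpace ℂ Z] {A : Set (X × Y)}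

/-- For fixed P the condition on Q is the kernel of a continuous functional; the extension is done
in one argument, then in the other. -/
theorem inner_eq_of_mem_closure_span
    (hA : ∀ P ∈ A, ∀ Q ∈ A, inner ℂ P.1 Q.1 = inner ℂ P.2 Q.2) {P Q : X × Y}
    (hP : P ∈ (Submodule.span ℂ A).topologicalClosure)
    (hQ : Q ∈ (Submodule.span ℂ A).topologicalClosure) : inner ℂ P.1 Q.1 = inner ℂ P.2 Q.2 := by
  have key : ∀ P : X × Y, (∀ Q ∈ A, inner ℂ P.1 Q.1 = inner ℂ P.2 Q.2) →
      ∀ Q ∈ (Submodule.span ℂ A).topologicalClosure, inner ℂ P.1 Q.1 = inner ℂ P.2 Q.2 := by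
    intro P hP Q hQ
    let T : X × Y →L[ℂ] ℂ := (innerSL ℂ P.1).comp (ContinuousLinearMap.fst ℂ X Y) -
      (innerSL ℂ P.2).comp (ContinuousLinearMap.snd ℂ X Y)
    have h : (Submodule.span ℂ A).topologicalClosure ≤ LinearMap.ker (T : X × Y →ₗ[ℂ] ℂ) := by
      refine Submodule.topologicalClosure_minimal _ (Submodule.span_le.2 fun Q hQ => ?_)
        T.isClosed_ker
      exact sub_eq_zero.2 (hP Q hQ)
    exact sub_eq_zero.1 (h hQ)
  refine key P (fun R hR => ?_) Q hQ
  have := key R (hA R hR) P hP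
  rw [← inner_conj_symm, this, inner_conj_symm]

theorem norm_eq_of_mem_closure_span
    (hA : ∀ P ∈ A, ∀ Q ∈ A, inner ℂ P.1 Q.1 = inner ℂ P.2 Q.2) {P : X × Y}
    (hP : P ∈ (Submodule.span ℂ A).topologicalClosure) : ‖P.1‖ = ‖P.2‖ := by
  have h := inner_eq_of_mem_closure_span hA hP hP
  rw [inner_self_eq_norm_sq_to_K, inner_self_eq_norm_sq_to_K] at h
  exact (sq_eq_sq₀ (norm_nonneg _) (norm_nonneg _)).1 (by exact_mod_cast h)

/-- An isometric image of a complete space is closed, so it contains the closed span of B. Applied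
to the two projections of the graph of U_{N,n}, it gives that the operator is everywhere defined and
onto. -/
theorem exists_mem_closure_span [CompleteSpace X] [CompleteSpace Y] (f : X × Y →L[ℂ] Z)
    (hf : ∀ P ∈ (Submodule.span ℂ A).topologicalClosure, ‖f P‖ = ‖P‖) {B : Set Z}
    (hB : ∀ z ∈ B, ∃ P ∈ A, f P = z) {z : Z} (hz : z ∈ (Submodule.span ℂ B).topologicalClosure) :
    ∃ P ∈ (Submodule.span ℂ A).topologicalClosure, f P = z := by
  set G := (Submodule.span ℂ A).topologicalClosure with hG
  have hGc : IsClosed (G : Set (X × Y)) := Submodule.isClosed_topologicalClosure _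
  have : CompleteSpace G := hGc.completeSpace_coe
  let g : G →ₗᵢ[ℂ] Z := ⟨(f : X × Y →ₗ[ℂ] Z).comp G.subtype, fun P => hf P P.2⟩
  have hc : IsClosed (LinearMap.range g.toLinearMap : Set Z) := by
    have := g.isometry.isClosedEmbedding.isClosed_range
    exact this
  have h : (Submodule.span ℂ B).topologicalClosure ≤ LinearMap.range g.toLinearMap := by
    refine Submodule.topologicalClosure_minimal _ (Submodule.span_le.2 fun z hz => ?_) hc
    obtain ⟨P, hP, rfl⟩ := hB z hz
    exact ⟨⟨P, Submodule.le_topologicalClosure _ (Submodule.subset_span hP)⟩, rfl⟩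
  obtain ⟨P, hP⟩ := h hz
  exact ⟨P, P.2, hP⟩

end Relation

/-! ### The many-body lowering operator -/

/-- The Hilbert space tensor power of the `n`-th Landau level, without statistics. -/
def tensorLevel (n N : ℕ) : Submodule ℂ (ManyBody N) :=
  (Submodule.span ℂ {Ψ | ∃ ψ : Fin N → OneBody,
      (∀ i, ψ i ∈ landauLevel n) ∧ Ψ = tensor ψ}).topologicalClosure

/-- The generators of the graph of `U_{N,n}`. -/
def loweringPairs (n N : ℕ) : Set (ManyBody N × ManyBody N) :=
  {P | ∃ ψ χ : Fin N → OneBody, (∀ i, IsLevelLowering n (ψ i) (χ i)) ∧ P = (tensor ψ, tensor χ)}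

theorem levelLowering_inner_eq (n N : ℕ) : ∀ P ∈ loweringPairs n N, ∀ Q ∈ loweringPairs n N,
    inner ℂ P.1 Q.1 = inner ℂ P.2 Q.2 := by
  rintro _ ⟨ψ, χ, h, rfl⟩ _ ⟨ψ', χ', h', rfl⟩
  simp only [inner_tensor]
  exact Finset.prod_congr rfl fun i _ => (h i).inner_eq (h' i)

theorem norm_eq_of_mem_levelLoweringGraph {n : ℕ} {P : ManyBody N × ManyBody N}
    (hP : P ∈ levelLoweringGraph n N) : ‖P.1‖ = ‖P.2‖ :=
  norm_eq_of_mem_closure_span (levelLowering_inner_eq n N) hP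

theorem levelLoweringGraph_unique {n : ℕ} {Ψ Φ Φ' : ManyBody N}
    (h : (Ψ, Φ) ∈ levelLoweringGraph n N) (h' : (Ψ, Φ') ∈ levelLoweringGraph n N) : Φ = Φ' := by
  have := norm_eq_of_mem_levelLoweringGraph (Submodule.sub_mem _ h h')
  simp only [Prod.mk_sub_mk, sub_self, norm_zero] at this
  exact sub_eq_zero.1 (norm_eq_zero.1 this.symm)

theorem exists_levelLoweringGraph {n : ℕ} {Ψ : ManyBody N} (hΨ : Ψ ∈ tensorLevel n N) :
    ∃ Φ, (Ψ, Φ) ∈ levelLoweringGraph n N := by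
  obtain ⟨P, hP, rfl⟩ := exists_mem_closure_span (A := loweringPairs n N)
    (ContinuousLinearMap.fst ℂ (ManyBody N) (ManyBody N)) (fun P hP => by
      rw [Prod.norm_def, ← norm_eq_of_mem_levelLoweringGraph hP, max_self]; rfl)
    (fun z hz => by
      obtain ⟨ψ, hψ, rfl⟩ := hz
      choose χ hχ using fun i => exists_isLevelLowering (hψ i)
      exact ⟨_, ⟨ψ, χ, hχ, rfl⟩, rfl⟩) hΨ
  exact ⟨P.2, hP⟩

theorem exists_levelLoweringGraph_of_zero (n : ℕ) {Φ : ManyBody N} (hΦ : Φ ∈ tensorLevel 0 N) :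
    ∃ Ψ, (Ψ, Φ) ∈ levelLoweringGraph n N := by
  obtain ⟨P, hP, rfl⟩ := exists_mem_closure_span (A := loweringPairs n N)
    (ContinuousLinearMap.snd ℂ (ManyBody N) (ManyBody N)) (fun P hP => by
      rw [Prod.norm_def, norm_eq_of_mem_levelLoweringGraph hP, max_self]; rfl)
    (fun z hz => by
      obtain ⟨χ, hχ, rfl⟩ := hz
      choose ψ hψ using fun i => exists_isLevelLowering_of_mem_zero n (hχ i)
      exact ⟨_, ⟨ψ, χ, hψ, rfl⟩, rfl⟩) hΦ
  exact ⟨P.1, hP⟩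

theorem snd_mem_of_mem_levelLoweringGraph {n : ℕ} {Ψ Φ : ManyBody N}
    (h : (Ψ, Φ) ∈ levelLoweringGraph n N) : Φ ∈ tensorLevel 0 N := by
  have hle : levelLoweringGraph n N ≤ (tensorLevel 0 N).comap (LinearMap.snd ℂ _ _) := by
    refine Submodule.topologicalClosure_minimal _ (Submodule.span_le.2 ?_)
      ((Submodule.isClosed_topologicalClosure _).preimage continuous_snd)
    rintro _ ⟨ψ, χ, h, rfl⟩
    exact Submodule.le_topologicalClosure _ (Submodule.subset_span ⟨χ, fun i => (h i).mem_zero, rfl⟩)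
  exact hle h

theorem perm_mem_levelLoweringGraph {n : ℕ} {Ψ Φ : ManyBody N} (σ : Equiv.Perm (Fin N))
    (h : (Ψ, Φ) ∈ levelLoweringGraph n N) :
    (Lp.compMeasurePreserving _ (measurePreserving_perm σ) Ψ,
      Lp.compMeasurePreserving _ (measurePreserving_perm σ) Φ) ∈ levelLoweringGraph n N := by
  let U : ManyBody N →L[ℂ] ManyBody N :=
    (Lp.compMeasurePreservingₗᵢ ℂ _ (measurePreserving_perm σ)).toContinuousLinearMap
  have hle : levelLoweringGraph n N ≤ (levelLoweringGraph n N).comap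
      (U.prodMap U : ManyBody N × ManyBody N →ₗ[ℂ] ManyBody N × ManyBody N) := by
    refine Submodule.topologicalClosure_minimal _ (Submodule.span_le.2 ?_)
      ((Submodule.isClosed_topologicalClosure _).preimage (U.prodMap U).continuous)
    rintro _ ⟨ψ, χ, h, rfl⟩
    refine Submodule.le_topologicalClosure _ (Submodule.subset_span
      ⟨ψ ∘ σ.symm, χ ∘ σ.symm, fun i => h _, ?_⟩)
    exact Prod.ext (tensor_comp_perm σ ψ) (tensor_comp_perm σ χ)
  exact hle h

theorem mem_symmetricStates_iff {s : Statistics} {Ψ : ManyBody N} :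
    Ψ ∈ symmetricStates s N ↔ ∀ σ : Equiv.Perm (Fin N),
      Lp.compMeasurePreserving _ (measurePreserving_perm σ) Ψ = s.factor σ • Ψ := by
  rw [symmetricStates, Submodule.mem_iInf]
  rfl

/-- The operator `U_{N,n}` is well defined on the `N`-particle space of the `n`-th Landau level,
and maps it to that of the lowest one. -/
theorem exists_lowered_state {s : Statistics} {n : ℕ} {Ψ : ManyBody N}
    (hΨ : Ψ ∈ manyBodyLevel s n N) : ∃ Φ ∈ manyBodyLevel s 0 N,
      (Ψ, Φ) ∈ levelLoweringGraph n N ∧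
      ∀ Φ', (Ψ, Φ') ∈ levelLoweringGraph n N ↔ Φ' = Φ := by
  obtain ⟨hΨ1, hΨ2⟩ := hΨ
  obtain ⟨Φ, hΦ⟩ := exists_levelLoweringGraph hΨ1
  refine ⟨Φ, ⟨snd_mem_of_mem_levelLoweringGraph hΦ, mem_symmetricStates_iff.2 fun σ => ?_⟩, hΦ,
    fun Φ' => ⟨fun h => levelLoweringGraph_unique h hΦ, fun h => h ▸ hΦ⟩⟩
  -- The permuted Φ and `s.factor σ • Φ` are both images of `s.factor σ • Ψ`, so they coincide.
  have h1 := perm_mem_levelLoweringGraph σ hΦ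
  rw [mem_symmetricStates_iff.1 hΨ2 σ] at h1
  exact levelLoweringGraph_unique h1 (Submodule.smul_mem _ (s.factor σ) hΦ)

/-! ### Representation by kernels -/

theorem ae_eq_of_mem_levelLoweringGraph {n : ℕ} {Ψ Φ : ManyBody N}
    (h : (Ψ, Φ) ∈ levelLoweringGraph n N) :
    Ψ =ᵐ[volume] fun r => inner ℂ (tensor fun i => landauKernel n (r i)) Φ := by
  have hle : levelLoweringGraph n N ≤
      kernelGraph volume fun r : Fin N → ℂ => tensor fun i => landauKernel n (r i) := by
    refine Submodule.topologicalClosure_minimal _ (Submodule.span_le.2 ?_) (isClosed_kernelGraph _)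
    rintro _ ⟨ψ, χ, h, rfl⟩
    refine mem_kernelGraph.2 ?_
    filter_upwards [coeFn_tensor ψ, ae_forall_eval fun i => (h i).ae_eq] with r h1 h2
    rw [h1, inner_tensor]
    exact Finset.prod_congr rfl fun i _ => h2 i
  exact hle h

/-! ### Laguerre operators and ladders in several variables -/

section SeveralVariables

variable {V W X : Type*} [NormedAddCommGroup V] [InnerProductSpace ℂ V] [NormedAddCommGroup W]
  [InnerProductSpace ℂ W] [NormedAddCommGroup X] [InnerProductSpace ℂ X] {ℓ : ℕ}

theorem contDiff_multilinear_ladder {κ : ℕ → ℂ → V} (hκ : IsConjLadder κ)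
    (T : ContinuousMultilinearMap ℂ (fun _ : Fin ℓ => V) W) (ν : Fin ℓ → ℕ) :
    ContDiff ℝ ∞ fun r : Fin ℓ → ℂ => T fun i => κ (ν i) (r i) := by
  have h1 : ContDiff ℝ ∞ T := (T.contDiff (n := ∞)).restrict_scalars ℝ
  refine h1.comp (contDiff_pi.2 fun i => ?_)
  exact (hκ.contDiff (ν i)).comp (contDiff_apply ℝ ℂ i)

theorem contDiff_semilinear (A : W →L⋆[ℂ] X) : ContDiff ℝ ∞ A := by
  let A' : W →L[ℝ] X :=
    { toFun := A
      map_add' := map_add A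
      map_smul' := fun r x => by
        have := A.map_smulₛₗ (r : ℂ) x
        simpa using this
      cont := A.continuous }
  exact A'.contDiff

theorem contDiff_inner_multilinear_ladder {κ : ℕ → ℂ → V} (hκ : IsConjLadder κ)
    (T : ContinuousMultilinearMap ℂ (fun _ : Fin ℓ => V) W) (ν : Fin ℓ → ℕ) (v : W) :
    ContDiff ℝ ∞ fun r : Fin ℓ → ℂ => inner ℂ (T fun i => κ (ν i) (r i)) v :=
  (contDiff_semilinear (innerSLFlip ℂ v)).comp (contDiff_multilinear_ladder hκ T ν)

theorem contDiff_norm_sq_multilinear_ladder {κ : ℕ → ℂ → V} (hκ : IsConjLadder κ)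
    (T : ContinuousMultilinearMap ℂ (fun _ : Fin ℓ => V) W) (A : W →L⋆[ℂ] X) (c : ℝ)
    (ν : Fin ℓ → ℕ) :
    ContDiff ℝ ∞ fun r : Fin ℓ → ℂ => c * ‖A (T fun i => κ (ν i) (r i))‖ ^ 2 :=
  contDiff_const.mul
    (((contDiff_semilinear A).comp (contDiff_multilinear_ladder hκ T ν)).norm_sq ℂ)

/-- Each particle gets its own level ν i. With all variables but the i-th frozen, the expression is
the squared norm of an antilinear image of κ, a ladder, so `IsLadder.laplacian_norm_sq` is the
recurrence in that variable. -/
theorem laguerreProduct_norm_sq {κ : ℕ → ℂ → V} (hκ : IsConjLadder κ)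
    (T : ContinuousMultilinearMap ℂ (fun _ : Fin ℓ => V) W) (A : W →L⋆[ℂ] X) (c : ℝ) (n : ℕ) :
    laguerreProduct n ℓ (fun r => c * ‖A (T fun i => κ 0 (r i))‖ ^ 2) =
      fun r => c * ‖A (T fun i => κ n (r i))‖ ^ 2 := by
  let G : (Fin ℓ → ℕ) → (Fin ℓ → ℂ) → ℝ := fun ν r => c * ‖A (T fun i => κ (ν i) (r i))‖ ^ 2
  have hG : ∀ ν i r, ContDiff ℝ 2 fun w => G ν (Function.update r i w) := fun ν i r =>
    (contDiff_infty.1 (contDiff_norm_sq_multilinear_ladder hκ T A c ν) 2).comp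
      (contDiff_update 2 r i)
  refine laguerreProduct_eq n G hG fun ν i => ?_
  funext r
  let L : V →L⋆[ℂ] X := A.comp (T.toContinuousLinearMap (fun j => κ (ν j) (r j)) i)
  have hL := hκ.map L
  have hGL : ∀ k w, G (Function.update ν i k) (Function.update r i w) = c * ‖L (κ k w)‖ ^ 2 := by
    intro k w
    have h : (fun j => κ (Function.update ν i k j) (Function.update r i w j)) =
        Function.update (fun j => κ (ν j) (r j)) i (κ k w) := by
      funext j
      by_cases hj : j = i
      · subst hj; simp
      · simp [hj]
    simp only [G, h]
    rfl
  have hGr : ∀ k, G (Function.update ν i k) r = c * ‖L (κ k (r i))‖ ^ 2 := fun k => by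
    rw [← hGL, Function.update_eq_self]
  have hG0 : ∀ w, G ν (Function.update r i w) = c * ‖L (κ (ν i) w)‖ ^ 2 := fun w => by
    rw [← hGL, Function.update_eq_self]
  have hGr0 : G ν r = c * ‖L (κ (ν i) (r i))‖ ^ 2 := by
    rw [← hG0, Function.update_eq_self]
  have hΔ : partialLaplacian i (G ν) r = c * Δ (fun w => ‖L (κ (ν i) w)‖ ^ 2) (r i) := by
    have hs : ContDiff ℝ 2 fun w => ‖L (κ (ν i) w)‖ ^ 2 :=
      contDiff_infty.1 (((contDiff_semilinear L).comp (hκ.contDiff (ν i))).norm_sq ℂ) 2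
    have := InnerProductSpace.laplacian_smul c (hs.contDiffAt (x := r i))
    simp only [partialLaplacian, hG0]
    exact this
  have hlad := hL.laplacian_norm_sq (ν i) (r i)
  simp only [Pi.smul_apply, Pi.sub_apply, scaledLaplacian, hΔ, hGr, hGr0, hlad, smul_eq_mul]
  ring

end SeveralVariables

/-! ### Splitting the particles into two groups -/

section Split

variable {N ℓ : ℕ} (hℓN : ℓ ≤ N)

/-- The first `ℓ` particles and the remaining ones. -/
def splitIndex : Fin ℓ ⊕ Fin (N - ℓ) ≃ Fin N :=
  finSumFinEquiv.trans (finCongr (Nat.add_sub_cancel' hℓN))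

/-- The positions of the first `ℓ` particles and those of the remaining ones. -/
def splitConfig : (Fin N → ℂ) ≃ᵐ (Fin ℓ → ℂ) × (Fin (N - ℓ) → ℂ) :=
  (MeasurableEquiv.piCongrLeft (fun _ : Fin N => ℂ) (splitIndex hℓN)).symm.trans
    (MeasurableEquiv.sumPiEquivProdPi fun _ => ℂ)

theorem measurePreserving_splitConfig : MeasurePreserving (splitConfig hℓN) volume volume :=
  (volume_measurePreserving_piCongrLeft (fun _ : Fin N => ℂ) (splitIndex hℓN)).symm.trans
    (volume_measurePreserving_sumPiEquivProdPi fun _ => ℂ)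

theorem joinConfig_inl (r : Fin ℓ → ℂ) (r' : Fin (N - ℓ) → ℂ) (j : Fin ℓ) :
    joinConfig r r' (splitIndex hℓN (.inl j)) = r j := by
  simp [joinConfig, splitIndex]

theorem joinConfig_inr (r : Fin ℓ → ℂ) (r' : Fin (N - ℓ) → ℂ) (j : Fin (N - ℓ)) :
    joinConfig r r' (splitIndex hℓN (.inr j)) = r' j := by
  simp [joinConfig, splitIndex]

theorem memLp_join (u : ManyBody ℓ) (Φ : ManyBody (N - ℓ)) :
    MemLp (fun w => u (splitConfig hℓN w).1 * Φ (splitConfig hℓN w).2) 2 volume := by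
  have h : MemLp (fun p : (Fin ℓ → ℂ) × (Fin (N - ℓ) → ℂ) => u p.1 * Φ p.2) 2 volume := by
    have hm : AEStronglyMeasurable (fun p : (Fin ℓ → ℂ) × (Fin (N - ℓ) → ℂ) => u p.1 * Φ p.2)
        volume :=
      ((Lp.aestronglyMeasurable u).comp_fst).mul ((Lp.aestronglyMeasurable Φ).comp_snd)
    rw [memLp_two_iff_integrable_sq_norm hm]
    have h1 := (memLp_two_iff_integrable_sq_norm (Lp.aestronglyMeasurable u)).1 (Lp.memLp u)
    have h2 := (memLp_two_iff_integrable_sq_norm (Lp.aestronglyMeasurable Φ)).1 (Lp.memLp Φ)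
    rw [Measure.volume_eq_prod]
    simpa only [norm_mul, mul_pow] using h1.mul_prod h2
  exact h.comp_measurePreserving (measurePreserving_splitConfig hℓN)

/-- The tensor product of a state of the first `ℓ` particles and one of the others. -/
def join (u : ManyBody ℓ) (Φ : ManyBody (N - ℓ)) : ManyBody N := (memLp_join hℓN u Φ).toLp _

theorem coeFn_join (u : ManyBody ℓ) (Φ : ManyBody (N - ℓ)) : join hℓN u Φ =ᵐ[volume]
    fun w => u (splitConfig hℓN w).1 * Φ (splitConfig hℓN w).2 :=
  (memLp_join hℓN u Φ).coeFn_toLp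

theorem ae_splitConfig_fst {p : (Fin ℓ → ℂ) → Prop} (hp : ∀ᵐ r, p r) :
    ∀ᵐ w, p (splitConfig hℓN w).1 :=
  (Measure.quasiMeasurePreserving_fst.comp
    (measurePreserving_splitConfig hℓN).quasiMeasurePreserving).ae hp

theorem ae_splitConfig_snd {p : (Fin (N - ℓ) → ℂ) → Prop} (hp : ∀ᵐ r, p r) :
    ∀ᵐ w, p (splitConfig hℓN w).2 :=
  (Measure.quasiMeasurePreserving_snd.comp
    (measurePreserving_splitConfig hℓN).quasiMeasurePreserving).ae hp

theorem inner_join (u u' : ManyBody ℓ) (Φ Φ' : ManyBody (N - ℓ)) :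
    inner ℂ (join hℓN u Φ) (join hℓN u' Φ') = inner ℂ u u' * inner ℂ Φ Φ' := by
  simp only [L2.inner_def]
  rw [← integral_prod_mul, ← Measure.volume_eq_prod,
    ← (measurePreserving_splitConfig hℓN).integral_comp (MeasurableEquiv.measurableEmbedding _)]
  refine integral_congr_ae ?_
  filter_upwards [coeFn_join hℓN u Φ, coeFn_join hℓN u' Φ'] with w h1 h2
  rw [h1, h2]
  simp only [RCLike.inner_apply, map_mul]
  ring

theorem norm_join (u : ManyBody ℓ) (Φ : ManyBody (N - ℓ)) : ‖join hℓN u Φ‖ = ‖u‖ * ‖Φ‖ := by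
  have h := inner_join hℓN u u Φ Φ
  simp only [inner_self_eq_norm_sq_to_K, ← mul_pow] at h
  have h2 : ‖join hℓN u Φ‖ ^ 2 = (‖u‖ * ‖Φ‖) ^ 2 := by exact_mod_cast h
  exact (sq_eq_sq₀ (norm_nonneg _) (by positivity)).1 h2

theorem tensor_eq_join (χ : Fin N → OneBody) : tensor χ =
    join hℓN (tensor fun j => χ (splitIndex hℓN (.inl j)))
      (tensor fun j => χ (splitIndex hℓN (.inr j))) := by
  refine Lp.ext ?_
  filter_upwards [coeFn_tensor χ, coeFn_join hℓN (tensor fun j => χ (splitIndex hℓN (.inl j)))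
    (tensor fun j => χ (splitIndex hℓN (.inr j))),
    ae_splitConfig_fst hℓN (coeFn_tensor fun j => χ (splitIndex hℓN (.inl j))),
    ae_splitConfig_snd hℓN (coeFn_tensor fun j => χ (splitIndex hℓN (.inr j)))] with w h1 h2 h3 h4
  rw [h1, h2, h3, h4, ← Equiv.prod_comp (splitIndex hℓN) fun i => χ i (w i),
    Fintype.prod_sum_type]
  rfl

/-- `join` as a continuous bilinear map. -/
def joinCLM : ManyBody ℓ →L[ℂ] ManyBody (N - ℓ) →L[ℂ] ManyBody N :=
  LinearMap.mkContinuous₂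
    (LinearMap.mk₂ ℂ (join hℓN)
      (fun u u' Φ => by
        refine Lp.ext ?_
        filter_upwards [coeFn_join hℓN (u + u') Φ, coeFn_join hℓN u Φ, coeFn_join hℓN u' Φ,
          Lp.coeFn_add (join hℓN u Φ) (join hℓN u' Φ),
          ae_splitConfig_fst hℓN (Lp.coeFn_add u u')] with w h1 h2 h3 h4 h5
        rw [h4, Pi.add_apply, h1, h2, h3, h5, Pi.add_apply, add_mul])
      (fun c u Φ => by
        refine Lp.ext ?_
        filter_upwards [coeFn_join hℓN (c • u) Φ, coeFn_join hℓN u Φ,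
          Lp.coeFn_smul c (join hℓN u Φ),
          ae_splitConfig_fst hℓN (Lp.coeFn_smul c u)] with w h1 h2 h3 h4
        rw [h3, Pi.smul_apply, h1, h2, h4, Pi.smul_apply, smul_mul_assoc])
      (fun u Φ Φ' => by
        refine Lp.ext ?_
        filter_upwards [coeFn_join hℓN u (Φ + Φ'), coeFn_join hℓN u Φ, coeFn_join hℓN u Φ',
          Lp.coeFn_add (join hℓN u Φ) (join hℓN u Φ'),
          ae_splitConfig_snd hℓN (Lp.coeFn_add Φ Φ')] with w h1 h2 h3 h4 h5
        rw [h4, Pi.add_apply, h1, h2, h3, h5, Pi.add_apply, mul_add])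
      (fun c u Φ => by
        refine Lp.ext ?_
        filter_upwards [coeFn_join hℓN u (c • Φ), coeFn_join hℓN u Φ,
          Lp.coeFn_smul c (join hℓN u Φ),
          ae_splitConfig_snd hℓN (Lp.coeFn_smul c Φ)] with w h1 h2 h3 h4
        rw [h3, Pi.smul_apply, h1, h2, h4, Pi.smul_apply, mul_smul_comm]))
    1 fun u Φ => by
      rw [LinearMap.mk₂_apply, norm_join, one_mul]

theorem joinCLM_apply (u : ManyBody ℓ) (Φ : ManyBody (N - ℓ)) :
    joinCLM hℓN u Φ = join hℓN u Φ := rfl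

/-- The partial inner product of the state `Ψ` with a state of the first `ℓ` particles. -/
def partialInner (Ψ : ManyBody N) : ManyBody ℓ →L⋆[ℂ] ManyBody (N - ℓ) :=
  ((ContinuousLinearMap.apply ℂ (ManyBody (N - ℓ)) Ψ).comp
    (ContinuousLinearMap.adjoint (𝕜 := ℂ) (E := ManyBody (N - ℓ))
      (F := ManyBody N)).toContinuousLinearEquiv.toContinuousLinearMap).comp
    (joinCLM hℓN)

theorem partialInner_apply (Ψ : ManyBody N) (u : ManyBody ℓ) :
    partialInner hℓN Ψ u = (joinCLM hℓN u).adjoint Ψ := rfl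

theorem inner_partialInner (Ψ : ManyBody N) (u : ManyBody ℓ) (Φ : ManyBody (N - ℓ)) :
    inner ℂ Φ (partialInner hℓN Ψ u) = inner ℂ (join hℓN u Φ) Ψ := by
  rw [partialInner_apply, ContinuousLinearMap.adjoint_inner_right, joinCLM_apply]

/-- On a product state the partial inner product is a multiple of the product of the remaining
factors; continuity does the rest. -/
theorem partialInner_mem {n : ℕ} {Ψ : ManyBody N} (hΨ : Ψ ∈ tensorLevel n N) (u : ManyBody ℓ) :
    partialInner hℓN Ψ u ∈ tensorLevel n (N - ℓ) := by
  have hle : tensorLevel n N ≤ (tensorLevel n (N - ℓ)).comap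
      ((joinCLM hℓN u).adjoint : ManyBody N →ₗ[ℂ] ManyBody (N - ℓ)) := by
    refine Submodule.topologicalClosure_minimal _ (Submodule.span_le.2 ?_)
      ((Submodule.isClosed_topologicalClosure _).preimage (joinCLM hℓN u).adjoint.continuous)
    rintro _ ⟨χ, hχ, rfl⟩
    have h : (joinCLM hℓN u).adjoint (tensor χ) =
        inner ℂ u (tensor fun j => χ (splitIndex hℓN (.inl j))) •
          tensor fun j => χ (splitIndex hℓN (.inr j)) := by
      refine ext_inner_left ℂ fun Φ => ?_
      rw [ContinuousLinearMap.adjoint_inner_right, joinCLM_apply, tensor_eq_join hℓN χ, inner_join,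
        inner_smul_right]
    change (joinCLM hℓN u).adjoint (tensor χ) ∈ tensorLevel n (N - ℓ)
    rw [h]
    exact Submodule.smul_mem _ _ (Submodule.le_topologicalClosure _
      (Submodule.subset_span ⟨_, fun j => hχ _, rfl⟩))
  exact hle hΨ

/-- The `N`-particle wave function in the `n`-th Landau level with lowered state `Ψ`. -/
def levelFun (n : ℕ) (Ψ : ManyBody N) (r : Fin N → ℂ) : ℂ :=
  inner ℂ (tensor fun i => landauKernel n (r i)) Ψ

theorem contDiff_levelFun (n : ℕ) (Ψ : ManyBody N) : ContDiff ℝ ∞ (levelFun n Ψ) :=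
  contDiff_inner_multilinear_ladder isConjLadder_landauKernel (tensorMap N) (fun _ => n) Ψ

/-- The kernel of the whole system factors, and the adjoint of `joinCLM` absorbs the frozen
particles. The identity holds at every point, so no null sets enter the densities. -/
theorem levelFun_joinConfig (n : ℕ) (Ψ : ManyBody N) (r : Fin ℓ → ℂ) (r' : Fin (N - ℓ) → ℂ) :
    levelFun n Ψ (joinConfig r r') =
      levelFun n (partialInner hℓN Ψ (tensor fun i => landauKernel n (r i))) r' := by
  rw [levelFun, levelFun, inner_partialInner, tensor_eq_join hℓN]
  simp only [joinConfig_inl, joinConfig_inr]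

/-- `levelFun n Φ` represents the preimage of Φ under the isometry U_{m,n}, so its L² norm is that
of Φ, whatever n is. -/
theorem levelFun_integral {m : ℕ} (n : ℕ) {Φ : ManyBody m} (hΦ : Φ ∈ tensorLevel 0 m) :
    Integrable (fun r => ‖levelFun n Φ r‖ ^ 2) volume ∧
      ∫ r, ‖levelFun n Φ r‖ ^ 2 = ‖Φ‖ ^ 2 := by
  obtain ⟨Y, hY⟩ := exists_levelLoweringGraph_of_zero n hΦ
  have hae : (fun r => ‖Y r‖ ^ 2) =ᵐ[volume] fun r => ‖levelFun n Φ r‖ ^ 2 := by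
    filter_upwards [ae_eq_of_mem_levelLoweringGraph hY] with r hr
    rw [hr]
    rfl
  have h1 := (memLp_two_iff_integrable_sq_norm (Lp.aestronglyMeasurable Y)).1 (Lp.memLp Y)
  refine ⟨h1.congr hae, ?_⟩
  rw [← integral_congr_ae hae, ← norm_eq_of_mem_levelLoweringGraph hY]
  have h2 : inner ℂ Y Y = ((‖Y‖ : ℝ) : ℂ) ^ 2 := inner_self_eq_norm_sq_to_K _
  rw [L2.inner_def] at h2
  simp only [inner_self_eq_norm_sq_to_K] at h2
  have h3 : ∫ r, ((‖Y r‖ ^ 2 : ℝ) : ℂ) = ((‖Y‖ ^ 2 : ℝ) : ℂ) := by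
    push_cast
    exact h2
  rw [integral_complex_ofReal] at h3
  exact_mod_cast h3

theorem particleDensity_levelFun (n : ℕ) {Ψ : ManyBody N} (hΨ : Ψ ∈ tensorLevel 0 N) :
    particleDensity ℓ (levelFun n Ψ) = fun r : Fin ℓ → ℂ => (N.choose ℓ : ℝ) *
      ‖partialInner hℓN Ψ (tensorMap ℓ fun i => landauKernel n (r i))‖ ^ 2 := by
  funext r
  rw [particleDensity]
  simp only [levelFun_joinConfig hℓN]
  rw [(levelFun_integral n (partialInner_mem hℓN hΨ _)).2, tensorMap_apply]

end Split

/-- U_0 is the identity, so `levelFun 0` represents the lowered state itself. -/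
theorem mem_levelLoweringGraph_zero {N : ℕ} {Φ : ManyBody N} (hΦ : Φ ∈ tensorLevel 0 N) :
    (Φ, Φ) ∈ levelLoweringGraph 0 N := by
  have hle : tensorLevel 0 N ≤ (levelLoweringGraph 0 N).comap
      (LinearMap.prod LinearMap.id LinearMap.id) := by
    refine Submodule.topologicalClosure_minimal _ (Submodule.span_le.2 ?_)
      ((Submodule.isClosed_topologicalClosure _).preimage (continuous_id.prodMk continuous_id))
    rintro _ ⟨χ, hχ, rfl⟩
    refine Submodule.le_topologicalClosure _ (Submodule.subset_span ⟨χ, χ, fun i => ?_, rfl⟩)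
    obtain ⟨c, hc⟩ := exists_eq_levelIsometry (hχ i)
    rw [hc]
    exact isLevelLowering_levelIsometry 0 c
  exact hle hΦ

end QuantumHall

end

open QuantumHall in
theorem mainTheorem2 (s : QuantumHall.Statistics) (n N ℓ : ℕ) (hℓ : 1 ≤ ℓ) (hℓN : ℓ ≤ N)
    (Ψn : QuantumHall.ManyBody N) (hΨn : Ψn ∈ QuantumHall.manyBodyLevel s n N) :
    ∃ Ψ0 ∈ QuantumHall.manyBodyLevel s 0 N,
      (∀ Φ : QuantumHall.ManyBody N,
        (Ψn, Φ) ∈ QuantumHall.levelLoweringGraph n N ↔ Φ = Ψ0) ∧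
      ∃ fn f0 : (Fin N → ℂ) → ℂ,
        ContDiff ℝ ∞ fn ∧ ContDiff ℝ ∞ f0 ∧ Ψn =ᵐ[volume] fn ∧ Ψ0 =ᵐ[volume] f0 ∧
        (∀ r : Fin ℓ → ℂ,
          Integrable (fun r' => ‖fn (QuantumHall.joinConfig r r')‖ ^ 2)
            (volume : Measure (Fin (N - ℓ) → ℂ)) ∧
          Integrable (fun r' => ‖f0 (QuantumHall.joinConfig r r')‖ ^ 2)
            (volume : Measure (Fin (N - ℓ) → ℂ))) ∧
        ContDiff ℝ ∞ (QuantumHall.particleDensity ℓ f0) ∧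
        ∀ r : Fin ℓ → ℂ,
          QuantumHall.particleDensity ℓ fn r =
            QuantumHall.laguerreProduct n ℓ (QuantumHall.particleDensity ℓ f0) r := by
  obtain ⟨Ψ0, hΨ0, hgraph, huniq⟩ := exists_lowered_state hΨn
  have hmem : Ψ0 ∈ tensorLevel 0 N := hΨ0.1
  have hint : ∀ k (r : Fin ℓ → ℂ), Integrable (fun r' => ‖levelFun k Ψ0 (joinConfig r r')‖ ^ 2)
      (volume : Measure (Fin (N - ℓ) → ℂ)) := by
    intro k r
    simp only [levelFun_joinConfig hℓN]
    exact (levelFun_integral k (partialInner_mem hℓN hmem _)).1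
  -- Both smooth representatives come from the same state Ψ0; only the level of the kernel differs.
  refine ⟨Ψ0, hΨ0, huniq, levelFun n Ψ0, levelFun 0 Ψ0, contDiff_levelFun n Ψ0,
    contDiff_levelFun 0 Ψ0, ae_eq_of_mem_levelLoweringGraph hgraph,
    ae_eq_of_mem_levelLoweringGraph (mem_levelLoweringGraph_zero hmem),
    fun r => ⟨hint n r, hint 0 r⟩, ?_, fun r => ?_⟩
  · rw [particleDensity_levelFun hℓN 0 hmem]
    exact contDiff_norm_sq_multilinear_ladder isConjLadder_landauKernel (tensorMap ℓ)
      (partialInner hℓN Ψ0) _ fun _ => 0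
  · rw [particleDensity_levelFun hℓN 0 hmem, particleDensity_levelFun hℓN n hmem,
      laguerreProduct_norm_sq isConjLadder_landauKernel]
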